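/- Let $\mathfrak C_{\mathbb Q}=\bigoplus_{i=0}^7\mathbb Q e_i$ be the Cayley numbers ($e_0=1$, $e_i^2=-1$, $e_ie_{i+1}=e_{i+3}$ and cyclically, indices mod $7$), with norm $N(x)=\sum x_i^2$ and trace $\mathrm{Tr}(x)=2x_0$, and let $\mathfrak o$ be the integral Cayley numbers with $\mathbb Z$-basis $e_0,\ e_1,\ e_2,\ -e_4,\ \tfrac12(e_1+e_2+e_3+e_4),\ \tfrac12(-e_0-e_1-e_4+e_5),\ \tfrac12(-e_0+e_1-e_2+e_6),\ \tfrac12(-e_0+e_2+e_4+e_7)$. Let $\mathfrak J(\mathbb Z)$ be the lattice of matrices $$T=\begin{pmatrix}a&x&y\\ \bar x&b&z\\ \bar y&\bar z&c\end{pmatrix},\qquad a,b,c\in\mathbb Z,\ x,y,z\in\mathfrak o,$$ with $\det T=abc-aN(z)-bN(y)-cN(x)+\mathrm{Tr}((xz)\bar y)$ and $$T\times T=\begin{pmatrix}bc-N(z)&y\bar z-cx&xz-by\\ z\bar y-c\bar x&ac-N(y)&\bar xy-az\\ \bar z\bar x-b\bar y&\bar yx-a\bar z&ab-N(x)\end{pmatrix}.$$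 Write $T>0$ (resp. $T\ge0$) if $a,b,c,\ ab-N(x),\ ac-N(y),\ bc-N(z),\ \det T$ are all positive (resp. non-negative). Write $T=T_1+T_2$, where $T_1$ is the symmetric matrix obtained by replacing $x,y,z$ by their $e_0$-coordinates. For $T>0$ let $d(T)=(d_1,d_2,d_3)=(\gcd(T),\gcd(T\times T),\det T)$, where $\gcd(X)$ is the largest $n$ with $X\in n\,\mathfrak J(\mathbb Z)$, and for a prime $p$ let $$f_T^p(X)=\sum_{\substack{l,j\ge0,\ l\le v_1\\ 2l+j\le v_2,\ 3l+2j\le v_3}}p^{8l+4j}X^{l+j}\bigl(1+X+\dots+X^{v_3-2l-2j}\bigr),\quad v_i=\mathrm{ord}_p(d_i),$$ and $\tilde f_T^p(X)=X^{v_3}f_T^p(X^{-2})$. Let $2k\ge20$, and let $f=\sum_{n\ge1}a_f(n)q^n$ be a Hecke eigen cusp form of weight $2k-8$ for $SL_2(\mathbb Z)$, normalized by $a_f(1)=1$, with $a_f(p)=p^{(2k-9)/2}(\alpha_p+\alpha_p^{-1})$ for every prime $p$. The Ikeda type lift of $f$ of weight $2k$ on the exceptional domain is $F_f(Z)=\sum_{T\in\mathfrak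 J(\mathbb Z),\,T>0}A_{F_f}(T)e^{2\pi i(T,Z)}$ with $$A_{F_f}(T)=\det(T)^{(2k-9)/2}\prod_{p\mid\det T}\tilde f_T^p(\alpha_p),$$ and the Fourier coefficient at $S$ of its restriction to the Siegel upper half space of degree $3$ is $A_{F_f|_{Sp_6}}(S)=\sum_{T\in\mathfrak J(\mathbb Z),\,T\ge0,\,T_1=S}A_{F_f}(T)$, where $A_{F_f}(T)=0$ unless $T>0$. Then, for $H=\mathrm{diag}(2,2,2)$, \begin{align*}A_{F_f|_{Sp_6}}(H)={}&a_f(2)^3+270\cdot2^{2k-9}a_f(2)+2268\,(a_f(4)+2^{2k-5})+378\,a_f(6)+55188\,a_f(4)\\&+459648\,a_f(3)+3752952\,a_f(2)+18192384.\end{align*} Moreover, the $T\in\mathfrak J(\mathbb Z)$ with $T>0$ and $T_1=H$ are classified by $d(T)$ as follows: $d(T)$ is one of $(1,1,1),(1,1,2),(1,1,3),(1,1,4),(1,1,6),(1,2,4),(2,4,8)$, and these values are taken by exactly $18192384,\ 3752952,\ 459648,\ 55188,\ 378,\ 2268,\ 1$ matrices $T$, respectively. -/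

import Mathlib

open scoped MatrixGroups Polynomial

noncomputable section

namespace ExceptionalRestriction

/-! ## Cayley numbers -/

/-- Cayley numbers (octonions) over `ℚ`, in coordinates with respect to `e₀, …, e₇`. Addition is
coordinatewise; the product is `omul` below (never the coordinatewise product). -/
abbrev Cayley : Type := Fin 8 → ℚ

/-- The octonion product: `e₀` is the identity, `eᵢ² = -e₀` and `eᵢ eᵢ₊₁ = eᵢ₊₃ = -eᵢ₊₁ eᵢ`,
`eᵢ₊₁ eᵢ₊₃ = eᵢ = -eᵢ₊₃ eᵢ₊₁`, `eᵢ₊₃ eᵢ = eᵢ₊₁ = -eᵢ eᵢ₊₃` for `i = 1, …, 7`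
(indices modulo `7`). -/
def omul (x y : Cayley) : Cayley :=
  ![x 0 * y 0 - x 1 * y 1 - x 2 * y 2 - x 3 * y 3 - x 4 * y 4 - x 5 * y 5 - x 6 * y 6 - x 7 * y 7,
    x 0 * y 1 + x 1 * y 0 + (x 5 * y 6 - x 6 * y 5) + (x 2 * y 4 - x 4 * y 2)
      + (x 3 * y 7 - x 7 * y 3),
    x 0 * y 2 + x 2 * y 0 + (x 6 * y 7 - x 7 * y 6) + (x 3 * y 5 - x 5 * y 3)
      + (x 4 * y 1 - x 1 * y 4),
    x 0 * y 3 + x 3 * y 0 + (x 7 * y 1 - x 1 * y 7) + (x 4 * y 6 - x 6 * y 4)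
      + (x 5 * y 2 - x 2 * y 5),
    x 0 * y 4 + x 4 * y 0 + (x 1 * y 2 - x 2 * y 1) + (x 5 * y 7 - x 7 * y 5)
      + (x 6 * y 3 - x 3 * y 6),
    x 0 * y 5 + x 5 * y 0 + (x 2 * y 3 - x 3 * y 2) + (x 6 * y 1 - x 1 * y 6)
      + (x 7 * y 4 - x 4 * y 7),
    x 0 * y 6 + x 6 * y 0 + (x 3 * y 4 - x 4 * y 3) + (x 7 * y 2 - x 2 * y 7)
      + (x 1 * y 5 - x 5 * y 1),
    x 0 * y 7 + x 7 * y 0 + (x 4 * y 5 - x 5 * y 4) + (x 1 * y 3 - x 3 * y 1)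
      + (x 2 * y 6 - x 6 * y 2)]

/-- The conjugate of a Cayley number. -/
def oconj (x : Cayley) : Cayley := fun i => if i = 0 then x 0 else -x i

/-- The norm of a Cayley number. -/
def onorm (x : Cayley) : ℚ := ∑ i, x i ^ 2

/-- The trace of a Cayley number. -/
def otrace (x : Cayley) : ℚ := 2 * x 0

/-- The basis `α₀, …, α₇` of the integral Cayley numbers. -/
def cayleyBasis : Fin 8 → Cayley :=
  ![![1, 0, 0, 0, 0, 0, 0, 0],
    ![0, 1, 0, 0, 0, 0, 0, 0],
    ![0, 0, 1, 0, 0, 0, 0, 0],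
    ![0, 0, 0, 0, -1, 0, 0, 0],
    ![0, 1 / 2, 1 / 2, 1 / 2, 1 / 2, 0, 0, 0],
    ![-1 / 2, -1 / 2, 0, 0, -1 / 2, 1 / 2, 0, 0],
    ![-1 / 2, 1 / 2, -1 / 2, 0, 0, 0, 1 / 2, 0],
    ![-1 / 2, 0, 1 / 2, 0, 1 / 2, 0, 0, 1 / 2]]

/-- The integral Cayley numbers `𝔬`. -/
def integralCayley : Submodule ℤ Cayley := Submodule.span ℤ (Set.range cayleyBasis)

/-! ## The exceptional Jordan algebra -/

/-- The element `(a, x, y; x̄, b, z; ȳ, z̄, c)` of the exceptional Jordan algebra over `ℚ`. -/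
@[ext]
structure Jordan where
  a : ℚ
  b : ℚ
  c : ℚ
  x : Cayley
  y : Cayley
  z : Cayley

namespace Jordan

/-- Multiplication of all entries by a scalar. -/
def scale (r : ℚ) (T : Jordan) : Jordan :=
  ⟨r * T.a, r * T.b, r * T.c, r • T.x, r • T.y, r • T.z⟩

/-- The product `T × T`. -/
def cross (T : Jordan) : Jordan where
  a := T.b * T.c - onorm T.z
  b := T.a * T.c - onorm T.y
  c := T.a * T.b - onorm T.x
  x := omul T.y (oconj T.z) - T.c • T.x
  y := omul T.x T.z - T.b • T.y
  z := omul (oconj T.x) T.y - T.a • T.z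

/-- The determinant. -/
def det (T : Jordan) : ℚ :=
  T.a * T.b * T.c - T.a * onorm T.z - T.b * onorm T.y - T.c * onorm T.x
    + otrace (omul (omul T.x T.z) (oconj T.y))

/-- Membership in the lattice `𝔍(ℤ)`: integers on the diagonal, integral Cayley numbers off it. -/
def IsIntegral (T : Jordan) : Prop :=
  (∃ n : ℤ, T.a = n) ∧ (∃ n : ℤ, T.b = n) ∧ (∃ n : ℤ, T.c = n) ∧
    T.x ∈ integralCayley ∧ T.y ∈ integralCayley ∧ T.z ∈ integralCayley

/-- Positive definiteness: all principal minors are positive. -/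
def IsPos (T : Jordan) : Prop :=
  0 < T.a ∧ 0 < T.b ∧ 0 < T.c ∧ 0 < T.det ∧
    0 < T.a * T.b - onorm T.x ∧ 0 < T.a * T.c - onorm T.y ∧ 0 < T.b * T.c - onorm T.z

/-- Positive semi-definiteness: all principal minors are non-negative. -/
def IsNonneg (T : Jordan) : Prop :=
  0 ≤ T.a ∧ 0 ≤ T.b ∧ 0 ≤ T.c ∧ 0 ≤ T.det ∧
    0 ≤ T.a * T.b - onorm T.x ∧ 0 ≤ T.a * T.c - onorm T.y ∧ 0 ≤ T.b * T.c - onorm T.z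

/-- The symmetric part `T₁` in the decomposition `T = T₁ + T₂`, where `T₂` is the imaginary
octonion part: every entry is replaced by its `e₀`-coordinate. -/
def symPart (T : Jordan) : Matrix (Fin 3) (Fin 3) ℚ :=
  !![T.a, T.x 0, T.y 0; T.x 0, T.b, T.z 0; T.y 0, T.z 0, T.c]

/-- The greatest common divisor of the entries of `T ∈ 𝔍(ℤ)`: the largest `n` with
`T ∈ n 𝔍(ℤ)`. -/
def content (T : Jordan) : ℕ :=
  sSup {n : ℕ | ∃ T' : Jordan, T'.IsIntegral ∧ T = scale n T'}

/-- The invariant `d(T) = (d₁, d₂, d₃) = (gcd(T), gcd(T × T), det T)`. -/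
def invariant (T : Jordan) : ℕ × ℕ × ℚ := (T.content, T.cross.content, T.det)

/-- `det T` as a natural number, for positive `T ∈ 𝔍(ℤ)`. -/
def detNat (T : Jordan) : ℕ := T.det.num.natAbs

end Jordan

/-! ## Fourier coefficients of the Ikeda type lift and of its restriction -/

/-- Karel's polynomial in terms of `eᵢ = ord_p dᵢ(T)`. If `T` is equivalent over `ℤ_p` to
`diag(t₁, t₂, t₃)` with `τ(i) = ord_p tᵢ` and `τ(1) ≤ τ(2) ≤ τ(3)`, then
`e₁ = τ(1)`, `e₂ = τ(1) + τ(2)`, `e₃ = τ(1) + τ(2) + τ(3)`. For `τ(1) = 0` this is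
`∑_{j ≤ τ(2)} (p⁴X)^j (1 + X + ⋯ + X^{τ(2) + τ(3) - 2j})`, and for `τ(1) = τ(2) = τ(3) = 1` it is
`X³ + (p⁸ + p⁴ + 1)X² + (p⁸ + p⁴ + 1)X + 1`. -/
def karelPoly (p e₁ e₂ e₃ : ℕ) : ℤ[X] :=
  ∑ l ∈ Finset.range (e₁ + 1),
    ∑ j ∈ (Finset.range (e₂ + 1)).filter (fun j => 2 * l + j ≤ e₂ ∧ 3 * l + 2 * j ≤ e₃),
      Polynomial.C ((p : ℤ) ^ (8 * l + 4 * j)) * Polynomial.X ^ (l + j) *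
        ∑ i ∈ Finset.range (e₃ - 2 * l - 2 * j + 1), Polynomial.X ^ i

/-- The polynomial `f_T^p`. -/
def localPoly (p : ℕ) (T : Jordan) : ℤ[X] :=
  karelPoly p (padicValNat p T.content) (padicValNat p T.cross.content) (padicValNat p T.detNat)

/-- `f̃_T^p(X) = X^{d_p} f_T^p(X⁻²)` with `d_p = ord_p (det T)`. -/
def localFactor (p : ℕ) (T : Jordan) (X : ℂ) : ℂ :=
  X ^ padicValNat p T.detNat * Polynomial.aeval (X⁻¹ ^ 2) (localPoly p T)

open Classical in
/-- The Fourier coefficient at `T` of the Ikeda type lift of weight `2k` with Satake parameters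
`{α p, (α p)⁻¹}`; it vanishes unless `T ∈ 𝔍(ℤ)` is positive. -/
def ikedaCoeff (k : ℕ) (α : ℕ → ℂ) (T : Jordan) : ℂ :=
  if T.IsIntegral ∧ T.IsPos then
    ((((T.det : ℚ) : ℝ) ^ ((2 * (k : ℝ) - 9) / 2) : ℝ) : ℂ) *
      ∏ p ∈ T.detNat.primeFactors, localFactor p T (α p)
  else 0

/-- The Fourier coefficient at `S` of the restriction to the Siegel upper half space of degree `3`
of `∑_T A(T) exp(2πi(T, Z))`: the sum of `A(T)` over all `T ∈ 𝔍(ℤ)_{≥ 0}` with `T₁ = S`. -/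
def restrictedCoeff (A : Jordan → ℂ) (S : Matrix (Fin 3) (Fin 3) ℚ) : ℂ :=
  ∑' T : {T : Jordan // T.IsIntegral ∧ T.IsNonneg ∧ T.symPart = S}, A T

/-! ## Hecke eigenforms -/

/-- The `n`-th Fourier coefficient at infinity of `f`. -/
def fourierCoeff (f : UpperHalfPlane → ℂ) (n : ℕ) : ℂ :=
  (UpperHalfPlane.qExpansion 1 f).coeff n

/-- The Hecke operator `T_n` in weight `w` and level one:
`(T_n f)(z) = n^{w-1} ∑_{ad = n} ∑_{0 ≤ b < d} d^{-w} f((az + b)/d)`. -/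
def heckeOp (w : ℤ) (n : ℕ) (f : UpperHalfPlane → ℂ) (z : UpperHalfPlane) : ℂ :=
  (n : ℂ) ^ (w - 1) * ∑ d ∈ n.divisors, ∑ b ∈ Finset.range d,
    (d : ℂ) ^ (-w) *
      f (UpperHalfPlane.ofComplex ((((n / d : ℕ) : ℂ) * (z : ℂ) + (b : ℂ)) / (d : ℂ)))

/-- A cusp form for `SL₂(ℤ)` which is an eigenvector of all Hecke operators `T_n`, `n ≥ 1`,
normalized by `a_f(1) = 1`. -/
def IsNormalizedEigenform {w : ℤ} (f : CuspForm 𝒮ℒ w) : Prop :=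
  fourierCoeff f 1 = 1 ∧ ∀ n : ℕ, 1 ≤ n → ∃ c : ℂ, ∀ z, heckeOp w n f z = c * f z

/-- `{α p, (α p)⁻¹}` are the Satake parameters of `f` of weight `2k - 8` at every prime `p`:
`a_f(p) = p^{(2k-9)/2} (α p + (α p)⁻¹)`. -/
def IsSatake (k : ℕ) (f : UpperHalfPlane → ℂ) (α : ℕ → ℂ) : Prop :=
  ∀ p : ℕ, p.Prime → α p ≠ 0 ∧
    fourierCoeff f p =
      (((p : ℝ) ^ ((2 * (k : ℝ) - 9) / 2) : ℝ) : ℂ) * (α p + (α p)⁻¹)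

end ExceptionalRestriction

end

/-! A positive `T` with symmetric part `diag(2, 2, 2)` is `twoDiag x y z`, where `x`, `y`, `z` are
purely imaginary integral octonions of norm less than 4 and the determinant is positive. The proof
counts these matrices by determinant, computes the contents of `T` and `T × T`, and evaluates the
local polynomials on the few resulting classes.

Counting. Doubled coordinates identify the imaginary lattice with the integer vectors whose
reduction modulo 2 lies in a binary code with eight words. Automorphisms of the octonions, together
with a sign change, preserve the number of `T` with given determinant and given entry `x`, so `x`
may be moved to one of five representatives (`ncard_fiber_representative`). For fixed `x` and `y`,
`2 det T` is a quadratic polynomial in the coordinates of `z` without mixed terms. Its generating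
function over all `z` of given parities therefore factors into one-variable sums. Evaluating it at
the base `2 ^ 40`, larger than the number of pairs `(y, z)`, makes every multiplicity a digit of one
natural number (`sum_pow_div_mod`, `genSum_mod`, `ncard_fiber_decode_representative`). The sum over
all short `x` is `ncard_det_eq`.

Contents. The diagonal part of `(T × T) × (T × T) = det T · T` gives `2 det T = (4 - N(x)) (4 -
N(y)) - N(x̄y - 2z)` and its analogues, and shows that the square of the content of `T × T` divides
`2 det T`. Hence `d(T) = (1, 1, det T)`, except for the scalar matrix 2 and for the 3 · 756 matrices
with a single non-zero octonion entry, of norm 2 (`mem_singleEntry_of_cross`,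
`invariant_of_notMem`).

Coefficients. On each class the local factors are polynomials in `α + α⁻¹`. They become Fourier
coefficients of `f` through the Satake relation and the action of `T₂`, which yields `a(4) = a(2)² -
2^(2k-9)` and `a(6) = a(2) a(3)`. Grouping the finite sum by `d(T)` gives the formula. -/

noncomputable section

namespace ExceptionalRestriction

/-! ## Octonion identities -/

/-- The inner product with `⟨x, x⟩ = N(x)`. -/
def oinner (x y : Cayley) : ℚ := ∑ i, x i * y i

theorem onorm_nonneg (x : Cayley) : 0 ≤ onorm x := Finset.sum_nonneg fun i _ => sq_nonneg (x i)

theorem onorm_eq_zero {x : Cayley} : onorm x = 0 ↔ x = 0 := by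
  unfold onorm
  rw [Finset.sum_eq_zero_iff_of_nonneg fun i _ => sq_nonneg (x i)]
  simp [funext_iff]

theorem onorm_smul (r : ℚ) (x : Cayley) : onorm (r • x) = r ^ 2 * onorm x := by
  simp [onorm, mul_pow, Finset.mul_sum]

theorem onorm_sub_smul (r : ℚ) (x y : Cayley) :
    onorm (x - r • y) = onorm x - 2 * r * oinner x y + r ^ 2 * onorm y := by
  simp only [onorm, oinner, Fin.sum_univ_eight, Pi.sub_apply, Pi.smul_apply, smul_eq_mul]
  ring

theorem onorm_omul (x y : Cayley) : onorm (omul x y) = onorm x * onorm y := by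
  simp only [onorm, Fin.sum_univ_eight, omul, Matrix.cons_val]
  ring

theorem onorm_oconj (x : Cayley) : onorm (oconj x) = onorm x := by
  simp [onorm, Fin.sum_univ_eight, oconj]

/-- Pairing an off-diagonal product in `T × T` with the matching entry of `T` gives the same
trilinear form for all three positions. This is the cross term when the norms of the entries of `T ×
T` are expanded. -/
theorem oinner_omul_oconj_right (x y z : Cayley) :
    2 * oinner (omul y (oconj z)) x = otrace (omul (omul x z) (oconj y)) := by
  simp only [oinner, otrace, Fin.sum_univ_eight, omul, oconj, Matrix.cons_val, Fin.isValue, if_true,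
    Fin.reduceEq, if_false]
  ring

theorem oinner_omul (x y z : Cayley) :
    2 * oinner (omul x z) y = otrace (omul (omul x z) (oconj y)) := by
  simp only [oinner, otrace, Fin.sum_univ_eight, omul, oconj, Matrix.cons_val, Fin.isValue, if_true,
    Fin.reduceEq, if_false]
  ring

theorem oinner_oconj_omul (x y z : Cayley) :
    2 * oinner (omul (oconj x) y) z = otrace (omul (omul x z) (oconj y)) := by
  simp only [oinner, otrace, Fin.sum_univ_eight, omul, oconj, Matrix.cons_val, Fin.isValue, if_true,
    Fin.reduceEq, if_false]
  ring

namespace Jordan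

/-- A diagonal entry of the adjoint identity `(T × T) × (T × T) = det T · T`. It serves twice: to
bound norms in terms of the determinant, and to bound the content of `T × T`. -/
theorem c_mul_det (T : Jordan) : T.c * T.det = T.cross.a * T.cross.b - onorm T.cross.x := by
  simp only [cross, det, onorm_sub_smul, onorm_omul, onorm_oconj]
  linear_combination -T.c * oinner_omul_oconj_right T.x T.y T.z

theorem b_mul_det (T : Jordan) : T.b * T.det = T.cross.a * T.cross.c - onorm T.cross.y := by
  simp only [cross, det, onorm_sub_smul, onorm_omul]
  linear_combination -T.b * oinner_omul T.x T.y T.z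

theorem a_mul_det (T : Jordan) : T.a * T.det = T.cross.b * T.cross.c - onorm T.cross.z := by
  simp only [cross, det, onorm_sub_smul, onorm_omul, onorm_oconj]
  linear_combination -T.a * oinner_oconj_omul T.x T.y T.z

end Jordan

/-! ## The lattice of integral Cayley numbers -/

theorem mem_integralCayley {x : Cayley} :
    x ∈ integralCayley ↔ ∃ c : Fin 8 → ℤ, ∑ i, c i • cayleyBasis i = x :=
  Submodule.mem_span_range_iff_exists_fun ℤ

theorem mem_integralCayley_coords {x : Cayley} :
    x ∈ integralCayley ↔ ∃ c0 c1 c2 c3 c4 c5 c6 c7 : ℤ,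
      x = ![(c0 : ℚ) - c5 / 2 - c6 / 2 - c7 / 2,
        c1 + c4 / 2 - c5 / 2 + c6 / 2, c2 + c4 / 2 - c6 / 2 + c7 / 2,
        c4 / 2, -c3 + c4 / 2 - c5 / 2 + c7 / 2, c5 / 2, c6 / 2, c7 / 2] := by
  have key : ∀ c : Fin 8 → ℤ, ∑ i, c i • cayleyBasis i =
      ![(c 0 : ℚ) - c 5 / 2 - c 6 / 2 - c 7 / 2, c 1 + c 4 / 2 - c 5 / 2 + c 6 / 2,
        c 2 + c 4 / 2 - c 6 / 2 + c 7 / 2,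
        c 4 / 2, -c 3 + c 4 / 2 - c 5 / 2 + c 7 / 2, c 5 / 2, c 6 / 2, c 7 / 2] := by
    intro c
    ext i
    simp only [Fin.sum_univ_eight, Pi.add_apply, zsmul_eq_mul, cayleyBasis]
    fin_cases i <;> simp <;> ring
  rw [mem_integralCayley]
  constructor
  · rintro ⟨c, rfl⟩
    exact ⟨c 0, c 1, c 2, c 3, c 4, c 5, c 6, c 7, key c⟩
  · rintro ⟨c0, c1, c2, c3, c4, c5, c6, c7, rfl⟩
    exact ⟨![c0, c1, c2, c3, c4, c5, c6, c7], by rw [key]; simp⟩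

theorem exists_int_onorm {x : Cayley} (hx : x ∈ integralCayley) : ∃ n : ℤ, onorm x = n := by
  obtain ⟨c0, c1, c2, c3, c4, c5, c6, c7, rfl⟩ := mem_integralCayley_coords.1 hx
  refine ⟨c0 ^ 2 + c1 ^ 2 + c2 ^ 2 + c3 ^ 2 + c4 ^ 2 + c5 ^ 2 + c6 ^ 2 + c7 ^ 2
    -- The norm form in the given basis has integral coefficients.
    - c0 * c5 - c0 * c6 - c0 * c7 + c1 * c4 - c1 * c5 + c1 * c6 + c2 * c4 - c2 * c6 + c2 * c7
    - c3 * c4 + c3 * c5 - c3 * c7 - c4 * c5 + c4 * c7, ?_⟩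
  simp only [onorm, Fin.sum_univ_eight, Matrix.cons_val]
  push_cast
  ring

/-- The purely imaginary Cayley number with the given doubled coordinates. -/
def halves (X : Fin 7 → ℤ) : Cayley := Fin.cons 0 fun i => (X i : ℚ) / 2

/-- The parity conditions describing doubled coordinates of purely imaginary integral Cayley
numbers. -/
def EvenCode (X : Fin 7 → ℤ) : Prop :=
  (X 0 + X 2 + X 6) % 2 = 0 ∧ (X 1 + X 2 + X 5 + X 6) % 2 = 0 ∧ (X 3 + X 2 + X 5) % 2 = 0 ∧
    (X 4 + X 5 + X 6) % 2 = 0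

theorem halves_injective : Function.Injective halves := by
  intro X Y h
  ext i
  have := congrFun h i.succ
  simp only [halves, Fin.cons_succ] at this
  exact_mod_cast (div_left_inj' (two_ne_zero)).1 this

theorem halves_mem_integralCayley {X : Fin 7 → ℤ} (hX : EvenCode X) :
    halves X ∈ integralCayley := by
  obtain ⟨h0, h1, h3, h4⟩ := hX
  -- The doubled coordinates at `e₃`, `e₅`, `e₆`, `e₇` are the last four basis coefficients; `a`,
  -- `b`, `c`, `d` are the first four, integral by the parity conditions.
  obtain ⟨a, ha⟩ : ∃ a, X 4 + X 5 + X 6 = 2 * a := ⟨(X 4 + X 5 + X 6) / 2, by omega⟩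
  obtain ⟨b, hb⟩ : ∃ b, X 0 - X 2 + X 4 - X 5 = 2 * b := ⟨(X 0 - X 2 + X 4 - X 5) / 2, by omega⟩
  obtain ⟨c, hc⟩ : ∃ c, X 1 - X 2 + X 5 - X 6 = 2 * c := ⟨(X 1 - X 2 + X 5 - X 6) / 2, by omega⟩
  obtain ⟨d, hd⟩ : ∃ d, -X 3 + X 2 - X 4 + X 6 = 2 * d :=
    ⟨(-X 3 + X 2 - X 4 + X 6) / 2, by omega⟩
  rw [← @Int.cast_inj ℚ] at ha hb hc hd
  push_cast at ha hb hc hd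
  refine mem_integralCayley_coords.2 ⟨a, b, c, d, X 2, X 4, X 5, X 6, ?_⟩
  ext i
  refine Fin.cases ?_ (fun j => ?_) i
  · simp only [halves, Fin.cons_zero, Matrix.cons_val]
    linarith
  · simp only [halves, Fin.cons_succ]
    fin_cases j <;> simp <;> linarith

theorem exists_halves_of_mem {x : Cayley} (hx : x ∈ integralCayley) (h0 : x 0 = 0) :
    ∃ X : Fin 7 → ℤ, EvenCode X ∧ halves X = x := by
  obtain ⟨c0, c1, c2, c3, c4, c5, c6, c7, rfl⟩ := mem_integralCayley_coords.1 hx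
  simp only [Matrix.cons_val] at h0
  have h : 2 * c0 = c5 + c6 + c7 := by
    rw [← @Int.cast_inj ℚ]
    push_cast
    linarith
  refine ⟨![2 * c1 + c4 - c5 + c6, 2 * c2 + c4 - c6 + c7, c4, -2 * c3 + c4 - c5 + c7, c5, c6, c7],
    ?_, ?_⟩
  · simp only [EvenCode, Matrix.cons_val]
    refine ⟨?_, ?_, ?_, ?_⟩ <;> omega
  · ext i
    refine Fin.cases ?_ (fun j => ?_) i
    · simp only [halves, Fin.cons_zero, Matrix.cons_val]
      linarith
    · simp only [halves, Fin.cons_succ]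
      fin_cases j <;> simp <;> ring

theorem onorm_halves (X : Fin 7 → ℤ) : onorm (halves X) = (∑ i, X i ^ 2 : ℤ) / 4 := by
  simp only [onorm, halves, Fin.sum_univ_succ, Fin.cons_zero, Fin.cons_succ]
  push_cast
  simp
  ring

/-! ## Positive elements with symmetric part `diag(2, 2, 2)` -/

/-- The element of the exceptional Jordan algebra with diagonal entries `2`. -/
def twoDiag (x y z : Cayley) : Jordan := ⟨2, 2, 2, x, y, z⟩

/-- The positive elements of `𝔍(ℤ)` with symmetric part `diag(2, 2, 2)`. -/
def posTwo : Set Jordan :=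
  {T | T.IsIntegral ∧ T.IsPos ∧ T.symPart = Matrix.diagonal ![2, 2, 2]}

/-- Purely imaginary integral Cayley numbers. -/
def imIntegral : Set Cayley := {x | x ∈ integralCayley ∧ x 0 = 0}

theorem det_twoDiag (x y z : Cayley) : (twoDiag x y z).det =
    8 - 2 * onorm x - 2 * onorm y - 2 * onorm z + otrace (omul (omul x z) (oconj y)) := by
  simp only [twoDiag, Jordan.det]
  ring

theorem det_twoDiag_z (x y z : Cayley) : 2 * (twoDiag x y z).det =
    (4 - onorm x) * (4 - onorm y) - onorm (omul (oconj x) y - (2 : ℚ) • z) := by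
  have := (twoDiag x y z).a_mul_det
  simp only [twoDiag, Jordan.cross] at this ⊢
  rw [this]
  ring

theorem det_twoDiag_y (x y z : Cayley) : 2 * (twoDiag x y z).det =
    (4 - onorm x) * (4 - onorm z) - onorm (omul x z - (2 : ℚ) • y) := by
  have := (twoDiag x y z).b_mul_det
  simp only [twoDiag, Jordan.cross] at this ⊢
  rw [this]
  ring

theorem det_twoDiag_x (x y z : Cayley) : 2 * (twoDiag x y z).det =
    (4 - onorm y) * (4 - onorm z) - onorm (omul y (oconj z) - (2 : ℚ) • x) := by
  have := (twoDiag x y z).c_mul_det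
  simp only [twoDiag, Jordan.cross] at this ⊢
  rw [this]
  ring

/-- If `N(z) ≥ 4`, then `2 det = (4 - N(x)) (4 - N(z)) - N(xz - 2y)` is not positive. This lets `z`
range over a whole box, with no norm constraint, when pairs are counted. -/
theorem onorm_lt_four_of_det_pos {x y z : Cayley} (hx : onorm x < 4)
    (hd : 0 < (twoDiag x y z).det) : onorm z < 4 := by
  have h1 := det_twoDiag_y x y z
  have h2 := onorm_nonneg (omul x z - (2 : ℚ) • y)
  by_contra! h
  nlinarith

theorem mem_posTwo {T : Jordan} : T ∈ posTwo ↔ ∃ x ∈ imIntegral, ∃ y ∈ imIntegral,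
    ∃ z ∈ imIntegral, T = twoDiag x y z ∧ onorm x < 4 ∧ onorm y < 4 ∧ onorm z < 4 ∧
      0 < T.det := by
  constructor
  · rintro ⟨⟨-, -, -, hx, hy, hz⟩, ⟨ha, hb, hc, hd, h1, h2, h3⟩, hs⟩
    obtain ⟨a, b, c, x, y, z⟩ := T
    have e := fun i j => congrFun (congrFun hs i) j
    have e00 := e 0 0
    have e11 := e 1 1
    have e22 := e 2 2
    have e01 := e 0 1
    have e02 := e 0 2
    have e12 := e 1 2
    simp [Jordan.symPart, Matrix.diagonal] at e00 e11 e22 e01 e02 e12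
    subst e00 e11 e22
    refine ⟨x, ⟨hx, e01⟩, y, ⟨hy, e02⟩, z, ⟨hz, e12⟩, rfl, ?_, ?_, ?_, hd⟩
    all_goals simp only at h1 h2 h3; linarith
  · rintro ⟨x, hx, y, hy, z, hz, rfl, h1, h2, h3, hd⟩
    refine ⟨⟨⟨2, by simp [twoDiag]⟩, ⟨2, by simp [twoDiag]⟩, ⟨2, by simp [twoDiag]⟩,
      hx.1, hy.1, hz.1⟩, ⟨?_, ?_, ?_, hd, ?_, ?_, ?_⟩, ?_⟩
    all_goals try (simp only [twoDiag]; linarith)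
    ext i j
    fin_cases i <;> fin_cases j <;>
      simp [Jordan.symPart, twoDiag, Matrix.diagonal, hx.2, hy.2, hz.2]

theorem twoDiag_mem_posTwo {x y z : Cayley} : twoDiag x y z ∈ posTwo ↔
    (x ∈ imIntegral ∧ y ∈ imIntegral ∧ z ∈ imIntegral) ∧ onorm x < 4 ∧ onorm y < 4 ∧
      onorm z < 4 ∧ 0 < (twoDiag x y z).det := by
  rw [mem_posTwo]
  constructor
  · rintro ⟨x', hx, y', hy, z', hz, h, hr⟩
    simp only [twoDiag, Jordan.mk.injEq, true_and] at h
    obtain ⟨rfl, rfl, rfl⟩ := h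
    exact ⟨⟨hx, hy, hz⟩, hr⟩
  · rintro ⟨⟨hx, hy, hz⟩, hr⟩
    exact ⟨x, hx, y, hy, z, hz, rfl, hr⟩

/-! ## Symmetries -/

/-- The elements of `posTwo` with given entry `x` and determinant `d`. -/
def fiber (x : Cayley) (d : ℚ) : Set Jordan := {T ∈ posTwo | T.x = x ∧ T.det = d}

/-- An involutive automorphism of the octonions which preserves the purely imaginary part of
`𝔬`. -/
structure IsInvolution (g : Cayley → Cayley) : Prop where
  map_omul (x y : Cayley) : omul (g x) (g y) = g (omul x y)
  map_oconj (x : Cayley) : g (oconj x) = oconj (g x)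
  onorm_map (x : Cayley) : onorm (g x) = onorm x
  map_apply_zero (x : Cayley) : g x 0 = x 0
  map_mem {x : Cayley} (hx : x ∈ imIntegral) : g x ∈ imIntegral
  map_map (x : Cayley) : g (g x) = x

namespace IsInvolution

variable {g : Cayley → Cayley}

theorem det_twoDiag (hg : IsInvolution g) (x y z : Cayley) :
    (twoDiag (g x) (g y) (g z)).det = (twoDiag x y z).det := by
  simp only [ExceptionalRestriction.det_twoDiag, hg.onorm_map, ← hg.map_oconj, hg.map_omul,
    otrace, hg.map_apply_zero]

theorem twoDiag_mem_posTwo (hg : IsInvolution g) {x y z : Cayley} (h : twoDiag x y z ∈ posTwo) :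
    twoDiag (g x) (g y) (g z) ∈ posTwo := by
  rw [ExceptionalRestriction.twoDiag_mem_posTwo] at h ⊢
  simp only [hg.det_twoDiag, hg.onorm_map]
  exact ⟨⟨hg.map_mem h.1.1, hg.map_mem h.1.2.1, hg.map_mem h.1.2.2⟩, h.2⟩

/-- Applying `g` to every entry is a bijection of fibers; being an involution, it is its own
inverse. -/
theorem ncard_fiber (hg : IsInvolution g) (x : Cayley) (d : ℚ) :
    (fiber (g x) d).ncard = (fiber x d).ncard := by
  have key : ∀ x, ∀ T ∈ fiber x d, twoDiag (g T.x) (g T.y) (g T.z) ∈ fiber (g x) d := by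
    rintro x T ⟨hT, rfl, rfl⟩
    obtain ⟨x, -, y, -, z, -, rfl, -⟩ := mem_posTwo.1 hT
    exact ⟨hg.twoDiag_mem_posTwo hT, rfl, hg.det_twoDiag _ _ _⟩
  symm
  refine Set.ncard_congr (fun T _ => twoDiag (g T.x) (g T.y) (g T.z)) (key x) ?_ ?_
  · intro T T' hT hT' h
    obtain ⟨x, -, y, -, z, -, rfl, -⟩ := mem_posTwo.1 hT.1
    obtain ⟨x', -, y', -, z', -, rfl, -⟩ := mem_posTwo.1 hT'.1
    simp only [twoDiag, Jordan.mk.injEq, true_and] at h ⊢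
    exact ⟨hg.map_map x ▸ hg.map_map x' ▸ congrArg g h.1,
      hg.map_map y ▸ hg.map_map y' ▸ congrArg g h.2.1,
      hg.map_map z ▸ hg.map_map z' ▸ congrArg g h.2.2⟩
  · intro T hT
    have := key _ T hT
    rw [hg.map_map] at this
    refine ⟨_, this, ?_⟩
    obtain ⟨x, -, y, -, z, -, rfl, -⟩ := mem_posTwo.1 hT.1
    simp only [twoDiag, hg.map_map]

end IsInvolution

theorem neg_mem_imIntegral {x : Cayley} (hx : x ∈ imIntegral) : -x ∈ imIntegral :=
  ⟨neg_mem hx.1, by simp [hx.2]⟩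

theorem onorm_neg (x : Cayley) : onorm (-x) = onorm x := by simp [onorm]

/-- This is conjugation by `diag(-1, 1, 1)`: the trilinear term changes sign twice. -/
theorem det_twoDiag_neg (x y z : Cayley) : (twoDiag (-x) (-y) z).det = (twoDiag x y z).det := by
  rw [det_twoDiag, det_twoDiag, onorm_neg, onorm_neg, ← oinner_omul, ← oinner_omul]
  simp only [oinner, Fin.sum_univ_eight, omul, Pi.neg_apply, Matrix.cons_val]
  ring

theorem ncard_fiber_neg (x : Cayley) (d : ℚ) : (fiber (-x) d).ncard = (fiber x d).ncard := by
  have key : ∀ x, ∀ T ∈ fiber x d, twoDiag (-T.x) (-T.y) T.z ∈ fiber (-x) d := by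
    rintro x T ⟨hT, rfl, rfl⟩
    obtain ⟨x, -, y, -, z, -, rfl, -⟩ := mem_posTwo.1 hT
    refine ⟨?_, rfl, det_twoDiag_neg _ _ _⟩
    rw [twoDiag_mem_posTwo] at hT ⊢
    simp only [twoDiag, onorm_neg] at hT ⊢
    have e := det_twoDiag_neg x y z
    simp only [twoDiag] at e
    rw [e]
    exact ⟨⟨neg_mem_imIntegral hT.1.1, neg_mem_imIntegral hT.1.2.1, hT.1.2.2⟩, hT.2⟩
  symm
  refine Set.ncard_congr (fun T _ => twoDiag (-T.x) (-T.y) T.z) (key x) ?_ ?_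
  · intro T T' hT hT' h
    obtain ⟨x, -, y, -, z, -, rfl, -⟩ := mem_posTwo.1 hT.1
    obtain ⟨x', -, y', -, z', -, rfl, -⟩ := mem_posTwo.1 hT'.1
    simpa only [twoDiag, Jordan.mk.injEq, true_and, neg_inj] using h
  · intro T hT
    have := key _ T hT
    rw [neg_neg] at this
    refine ⟨_, this, ?_⟩
    obtain ⟨x, -, y, -, z, -, rfl, -⟩ := mem_posTwo.1 hT.1
    simp only [twoDiag, neg_neg]

/-! ## Explicit automorphisms -/

/-- The entry of a matrix given by the list of its rows. -/
def entry (M : List (List ℤ)) (i j : Fin 7) : ℤ := (M.getD i []).getD j 0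

/-- The map which fixes `e₀` and acts on `e₁, …, e₇` by half the given matrix. -/
def halfMul (M : List (List ℤ)) (x : Cayley) : Cayley :=
  Fin.cons (x 0) fun i => (∑ j, entry M i j * x j.succ) / 2

/-- Twice the matrices of some involutive automorphisms of `𝔬`. -/
def involutions : List (List (List ℤ)) :=
   [[[0, 2, 0, 0, 0, 0, 0], [2, 0, 0, 0, 0, 0, 0], [0, 0, 2, 0, 0, 0, 0],
     [0, 0, 0, -2, 0, 0, 0], [0, 0, 0, 0, 0, 0, 2], [0, 0, 0, 0, 0, -2, 0],
     [0, 0, 0, 0, 2, 0, 0]],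
    [[-2, 0, 0, 0, 0, 0, 0], [0, 0, 0, 0, 0, -2, 0], [0, 0, 2, 0, 0, 0, 0],
     [0, 0, 0, 0, -2, 0, 0], [0, 0, 0, -2, 0, 0, 0], [0, -2, 0, 0, 0, 0, 0],
     [0, 0, 0, 0, 0, 0, -2]],
    [[0, 0, 0, 0, 2, 0, 0], [0, 0, 0, 0, 0, 0, 2], [0, 0, -2, 0, 0, 0, 0],
     [0, 0, 0, 2, 0, 0, 0], [2, 0, 0, 0, 0, 0, 0], [0, 0, 0, 0, 0, -2, 0],
     [0, 2, 0, 0, 0, 0, 0]],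
    [[-2, 0, 0, 0, 0, 0, 0], [0, 0, 0, -2, 0, 0, 0], [0, 0, -2, 0, 0, 0, 0],
     [0, -2, 0, 0, 0, 0, 0], [0, 0, 0, 0, 0, -2, 0], [0, 0, 0, 0, -2, 0, 0],
     [0, 0, 0, 0, 0, 0, 2]],
    [[-2, 0, 0, 0, 0, 0, 0], [0, -2, 0, 0, 0, 0, 0], [0, 0, -2, 0, 0, 0, 0],
     [0, 0, 0, 2, 0, 0, 0], [0, 0, 0, 0, 2, 0, 0], [0, 0, 0, 0, 0, -2, 0],
     [0, 0, 0, 0, 0, 0, 2]],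
    [[-2, 0, 0, 0, 0, 0, 0], [0, -2, 0, 0, 0, 0, 0], [0, 0, 2, 0, 0, 0, 0],
     [0, 0, 0, 2, 0, 0, 0], [0, 0, 0, 0, -2, 0, 0], [0, 0, 0, 0, 0, 2, 0],
     [0, 0, 0, 0, 0, 0, -2]],
    [[1, 1, 0, 0, 1, 0, 1], [1, 1, 0, 0, -1, 0, -1], [0, 0, 0, 2, 0, 0, 0],
     [0, 0, 2, 0, 0, 0, 0], [1, -1, 0, 0, -1, 0, 1], [0, 0, 0, 0, 0, -2, 0],
     [1, -1, 0, 0, 1, 0, -1]],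
    [[0, 0, 2, 0, 0, 0, 0], [0, -1, 0, -1, -1, 1, 0], [2, 0, 0, 0, 0, 0, 0],
     [0, -1, 0, -1, 1, -1, 0], [0, -1, 0, 1, 1, 1, 0], [0, 1, 0, -1, 1, 1, 0],
     [0, 0, 0, 0, 0, 0, -2]],
    [[-2, 0, 0, 0, 0, 0, 0], [0, -1, 0, 1, 1, -1, 0], [0, 0, 0, 0, 0, 0, -2],
     [0, 1, 0, 1, -1, -1, 0], [0, 1, 0, -1, 1, -1, 0], [0, -1, 0, -1, -1, -1, 0],
     [0, 0, -2, 0, 0, 0, 0]],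
    [[0, -2, 0, 0, 0, 0, 0], [-2, 0, 0, 0, 0, 0, 0], [0, 0, -2, 0, 0, 0, 0],
     [0, 0, 0, -2, 0, 0, 0], [0, 0, 0, 0, 0, 0, 2], [0, 0, 0, 0, 0, 2, 0],
     [0, 0, 0, 0, 2, 0, 0]],
    [[0, 1, 0, -1, 1, 1, 0], [1, 0, 0, -1, 0, -1, -1], [0, 0, 1, 1, 1, 0, -1],
     [-1, -1, 1, -1, 0, 0, 0], [1, 0, 1, 0, -1, 1, 0], [1, -1, 0, 0, 1, 0, 1],
     [0, -1, -1, 0, 0, 1, -1]]]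

theorem halfMul_eq (M : List (List ℤ)) (x : Cayley) : halfMul M x = ![x 0,
    (entry M 0 0 * x 1 + entry M 0 1 * x 2 + entry M 0 2 * x 3 + entry M 0 3 * x 4
      + entry M 0 4 * x 5 + entry M 0 5 * x 6 + entry M 0 6 * x 7) / 2,
    (entry M 1 0 * x 1 + entry M 1 1 * x 2 + entry M 1 2 * x 3 + entry M 1 3 * x 4
      + entry M 1 4 * x 5 + entry M 1 5 * x 6 + entry M 1 6 * x 7) / 2,
    (entry M 2 0 * x 1 + entry M 2 1 * x 2 + entry M 2 2 * x 3 + entry M 2 3 * x 4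
      + entry M 2 4 * x 5 + entry M 2 5 * x 6 + entry M 2 6 * x 7) / 2,
    (entry M 3 0 * x 1 + entry M 3 1 * x 2 + entry M 3 2 * x 3 + entry M 3 3 * x 4
      + entry M 3 4 * x 5 + entry M 3 5 * x 6 + entry M 3 6 * x 7) / 2,
    (entry M 4 0 * x 1 + entry M 4 1 * x 2 + entry M 4 2 * x 3 + entry M 4 3 * x 4
      + entry M 4 4 * x 5 + entry M 4 5 * x 6 + entry M 4 6 * x 7) / 2,
    (entry M 5 0 * x 1 + entry M 5 1 * x 2 + entry M 5 2 * x 3 + entry M 5 3 * x 4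
      + entry M 5 4 * x 5 + entry M 5 5 * x 6 + entry M 5 6 * x 7) / 2,
    (entry M 6 0 * x 1 + entry M 6 1 * x 2 + entry M 6 2 * x 3 + entry M 6 3 * x 4
      + entry M 6 4 * x 5 + entry M 6 5 * x 6 + entry M 6 6 * x 7) / 2] := by
  ext i
  fin_cases i <;> simp [halfMul, Fin.sum_univ_seven] <;> rfl

theorem forall_mem_involutions {p : List (List ℤ) → Prop}
    (h : ∀ i (hi : i < 11), p (involutions[i]'hi)) : ∀ M ∈ involutions, p M := by
  intro M hM
  obtain ⟨i, hi, rfl⟩ := List.getElem_of_mem hM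
  exact h i hi

-- Multiplicativity is a polynomial identity in the coordinates, verified for each of the eleven
-- matrices.
set_option maxHeartbeats 4000000 in
theorem omul_halfMul (x y : Cayley) : ∀ M ∈ involutions,
    omul (halfMul M x) (halfMul M y) = halfMul M (omul x y) := by
  refine forall_mem_involutions fun i hi => ?_
  interval_cases i
  all_goals
    simp only [halfMul_eq, omul, involutions, entry, List.getElem_cons_zero,
      List.getElem_cons_succ, List.getD_cons_zero, List.getD_cons_succ, Fin.isValue,
      Fin.coe_ofNat_eq_mod, Nat.reduceMod, Matrix.cons_val, Int.cast_zero, zero_mul, zero_add,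
      add_zero,
      Int.cast_one, one_mul, Int.cast_neg, Int.cast_ofNat]
    ext i
    fin_cases i <;> simp only [Fin.reduceFinMk, Fin.isValue, Fin.zero_eta, Fin.mk_one,
      Matrix.cons_val] <;> ring

theorem oconj_halfMul (M : List (List ℤ)) (x : Cayley) :
    halfMul M (oconj x) = oconj (halfMul M x) := by
  ext i
  refine Fin.cases ?_ (fun j => ?_) i
  · simp [halfMul, oconj]
  · simp [halfMul, oconj, Fin.succ_ne_zero, neg_div]

theorem onorm_halfMul (x : Cayley) : ∀ M ∈ involutions, onorm (halfMul M x) = onorm x := by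
  refine forall_mem_involutions fun i hi => ?_
  interval_cases i
  all_goals
    simp only [halfMul_eq, onorm, Fin.sum_univ_eight, involutions, entry, List.getElem_cons_zero,
      List.getElem_cons_succ, List.getD_cons_zero, List.getD_cons_succ, Fin.isValue,
      Fin.coe_ofNat_eq_mod, Nat.reduceMod, Matrix.cons_val, Int.cast_zero, zero_mul, zero_add,
      add_zero, Int.cast_one, one_mul, Int.cast_neg, Int.cast_ofNat]
    ring

theorem halfMul_halfMul (x : Cayley) : ∀ M ∈ involutions, halfMul M (halfMul M x) = x := by
  refine forall_mem_involutions fun i hi => ?_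
  interval_cases i
  all_goals
    simp only [halfMul_eq, involutions, entry, List.getElem_cons_zero,
      List.getElem_cons_succ, List.getD_cons_zero, List.getD_cons_succ, Fin.isValue,
      Fin.coe_ofNat_eq_mod, Nat.reduceMod, Matrix.cons_val, Int.cast_zero, zero_mul, zero_add,
      add_zero, Int.cast_one, one_mul, Int.cast_neg, Int.cast_ofNat]
    ext i
    fin_cases i <;> simp only [Fin.reduceFinMk, Fin.isValue, Fin.zero_eta, Fin.mk_one,
      Matrix.cons_val] <;> ring

theorem halfMul_halves {M : List (List ℤ)} {X Y : Fin 7 → ℤ}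
    (h : ∀ i, 2 * Y i = ∑ j, entry M i j * X j) : halfMul M (halves X) = halves Y := by
  ext i
  refine Fin.cases ?_ (fun j => ?_) i
  · simp [halfMul, halves]
  · have := congrArg (Int.cast (R := ℚ)) (h j)
    push_cast at this
    simp only [halfMul, halves, Fin.cons_succ, mul_div_assoc', ← Finset.sum_div, ← this]
    ring

instance : DecidablePred EvenCode := fun _ => inferInstanceAs (Decidable (_ ∧ _))

theorem EvenCode.add {X Y : Fin 7 → ℤ} (hX : EvenCode X) (hY : EvenCode Y) : EvenCode (X + Y) := by
  obtain ⟨h0, h1, h2, h3⟩ := hX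
  obtain ⟨k0, k1, k2, k3⟩ := hY
  simp only [EvenCode, Pi.add_apply]
  omega

theorem EvenCode.smul {X : Fin 7 → ℤ} (hX : EvenCode X) (c : ℤ) : EvenCode (c • X) := by
  obtain ⟨h0, h1, h2, h3⟩ := hX
  simp only [EvenCode, Pi.smul_apply, smul_eq_mul, ← mul_add]
  exact ⟨by simp [Int.mul_emod, h0], by simp [Int.mul_emod, h1], by simp [Int.mul_emod, h2],
    by simp [Int.mul_emod, h3]⟩

/-- A basis of the lattice described by `EvenCode`. -/
def evenCodeBasis : List (Fin 7 → ℤ) :=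
  [![1, 1, 1, 1, 0, 0, 0], ![0, 1, 0, 1, 1, 1, 0], ![1, 1, 0, 0, 1, 0, 1], ![2, 0, 0, 0, 0, 0, 0],
    ![0, 2, 0, 0, 0, 0, 0], ![0, 0, 0, 2, 0, 0, 0], ![0, 0, 0, 0, 2, 0, 0]]

theorem evenCode_induction {p : (Fin 7 → ℤ) → Prop} (hadd : ∀ X Y, p X → p Y → p (X + Y))
    (hsmul : ∀ (c : ℤ) X, p X → p (c • X)) (hb : ∀ X ∈ evenCodeBasis, p X)
    {X : Fin 7 → ℤ} (hX : EvenCode X) : p X := by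
  obtain ⟨h0, h1, h2, h3⟩ := hX
  -- Coordinates 2, 5 and 6 are free and fix the combination of the three code generators; the other
  -- four are then correct up to even integers.
  obtain ⟨a, ha⟩ : ∃ a, X 0 = X 2 + X 6 + 2 * a := ⟨(X 0 - X 2 - X 6) / 2, by omega⟩
  obtain ⟨b, hb⟩ : ∃ b, X 1 = X 2 + X 5 + X 6 + 2 * b :=
    ⟨(X 1 - X 2 - X 5 - X 6) / 2, by omega⟩
  obtain ⟨c, hc⟩ : ∃ c, X 3 = X 2 + X 5 + 2 * c := ⟨(X 3 - X 2 - X 5) / 2, by omega⟩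
  obtain ⟨d, hd⟩ : ∃ d, X 4 = X 5 + X 6 + 2 * d := ⟨(X 4 - X 5 - X 6) / 2, by omega⟩
  have : X = X 2 • ![1, 1, 1, 1, 0, 0, 0] + X 5 • ![0, 1, 0, 1, 1, 1, 0] +
      X 6 • ![1, 1, 0, 0, 1, 0, 1] + a • ![2, 0, 0, 0, 0, 0, 0] + b • ![0, 2, 0, 0, 0, 0, 0] +
      c • ![0, 0, 0, 2, 0, 0, 0] + d • ![0, 0, 0, 0, 2, 0, 0] := by
    ext i
    fin_cases i <;> simp [ha, hb, hc, hd] <;> ring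
  rw [this]
  refine hadd _ _ (hadd _ _ (hadd _ _ (hadd _ _ (hadd _ _ (hadd _ _ ?_ ?_) ?_) ?_) ?_) ?_) ?_
  all_goals
    refine hsmul _ _ (‹∀ X ∈ evenCodeBasis, p X› _ ?_)
    simp [evenCodeBasis]

/-- Lattice preservation is linear, so checking it on a basis suffices. -/
theorem halfMul_evenCodeBasis : ∀ M ∈ involutions, ∀ X ∈ evenCodeBasis,
    (∀ i, 2 * ((∑ j, entry M i j * X j) / 2) = ∑ j, entry M i j * X j) ∧
      EvenCode fun i => (∑ j, entry M i j * X j) / 2 := by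
  decide +kernel

theorem halfMul_mem_imIntegral {x : Cayley} (hx : x ∈ imIntegral) :
    ∀ M ∈ involutions, halfMul M x ∈ imIntegral := by
  intro M hM
  refine ⟨?_, hx.2⟩
  obtain ⟨X, hX, rfl⟩ := exists_halves_of_mem hx.1 hx.2
  suffices h : ∃ Y, (∀ i, 2 * Y i = ∑ j, entry M i j * X j) ∧ EvenCode Y by
    obtain ⟨Y, h1, h2⟩ := h
    rw [halfMul_halves h1]
    exact halves_mem_integralCayley h2
  refine evenCode_induction
    (p := fun X => ∃ Y, (∀ i, 2 * Y i = ∑ j, entry M i j * X j) ∧ EvenCode Y) ?_ ?_ ?_ hX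
  · rintro X X' ⟨Y, h1, h2⟩ ⟨Y', h1', h2'⟩
    refine ⟨Y + Y', fun i => ?_, h2.add h2'⟩
    simp only [Pi.add_apply, mul_add, Finset.sum_add_distrib, h1, h1']
  · rintro c X ⟨Y, h1, h2⟩
    refine ⟨c • Y, fun i => ?_, h2.smul c⟩
    simp only [Pi.smul_apply, smul_eq_mul, mul_left_comm _ c, ← Finset.mul_sum, h1]
  · exact fun X hX => ⟨_, halfMul_evenCodeBasis M hM X hX⟩

theorem isInvolution_halfMul {M : List (List ℤ)} (hM : M ∈ involutions) :
    IsInvolution (halfMul M) where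
  map_omul x y := omul_halfMul x y M hM
  map_oconj := oconj_halfMul M
  onorm_map x := onorm_halfMul x M hM
  map_apply_zero _ := rfl
  map_mem hx := halfMul_mem_imIntegral hx M hM
  map_map x := halfMul_halfMul x M hM

/-! ## Enumeration of short vectors

A coordinate `-3, …, 3` of a doubled purely imaginary Cayley number is encoded by the digit
`0, …, 6`. -/

/-- The vector of doubled coordinates encoded by a list of digits. -/
def ofDigits (l : List ℕ) : Fin 7 → ℤ := fun i => (l.getD i 0 : ℤ) - 3

/-- The digits encoding odd, respectively even coordinates. -/
def digits (odd : Bool) : List ℕ := cond odd [0, 2, 4, 6] [1, 3, 5]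

/-- The solutions modulo `2` of the conditions in `EvenCode`. -/
def codewords : List (List Bool) :=
  [[false, false, false, false, false, false, false],
    [true, true, true, true, false, false, false],
    [false, true, false, true, true, true, false],
    [true, true, false, false, true, false, true],
    [true, false, true, false, true, true, false],
    [false, false, true, true, true, false, true],
    [true, false, false, true, false, true, true],
    [false, true, true, false, false, true, true]]

/-- The lists of digits with given parities of the encoded coordinates. -/
def box : List Bool → List (List ℕ)
  | [] => [[]]
  | c :: cs => (digits c).flatMap fun u => (box cs).map fun l => u :: l

/-- The codes of all lattice vectors with doubled coordinates in `[-3, 3]`. -/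
def boxes : List (List ℕ) := codewords.flatMap box

/-- A sum over a list, in a form suited to evaluation. -/
def listSum {α : Type} (l : List α) (f : α → ℕ) : ℕ := List.rec 0 (fun a _ r => Nat.add (f a) r) l

/-- The square of the coordinate encoded by a digit. -/
def digitSq (u : ℕ) : ℕ := Nat.sub (Nat.add (Nat.mul u u) 9) (Nat.mul 6 u)

/-- The sum of the squares of the encoded coordinates. -/
def digitNorm (l : List ℕ) : ℕ := listSum l digitSq

/-- The sum of `k` over the elements of `box l` whose `digitNorm` is at most the given bound. -/
def boundedSum (l : List Bool) : ℕ → (List ℕ → ℕ) → ℕ :=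
  List.rec (fun _ k => k []) (fun c _ r b k => listSum (digits c) fun u =>
    cond (Nat.ble (digitSq u) b) (r (Nat.sub b (digitSq u)) fun l => k (u :: l)) 0) l

/-- The sum of `k` over all codes of lattice vectors of norm less than `4`. -/
def shortSum (k : List ℕ → ℕ) : ℕ := listSum codewords fun c => boundedSum c 12 k

/-- The codes of the purely imaginary integral Cayley numbers of norm less than `4`. -/
def shortVectors : Finset (List ℕ) := {l ∈ boxes.toFinset | digitNorm l ≤ 12}

theorem listSum_eq {α : Type} (l : List α) (f : α → ℕ) : listSum l f = (l.map f).sum := by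
  induction l with
  | nil => rfl
  | cons a l ih => rw [List.map_cons, List.sum_cons, ← ih]; rfl

theorem sum_map_flatMap {α β : Type} (l : List α) (f : α → List β) (g : β → ℕ) :
    ((l.flatMap f).map g).sum = (l.map fun a => ((f a).map g).sum).sum := by
  induction l with
  | nil => rfl
  | cons a l ih => simp [ih]

/-- Cutting off a branch once the remaining bound is exceeded loses nothing, since the later squares
are non-negative. -/
theorem boundedSum_eq (c : List Bool) (b : ℕ) (k : List ℕ → ℕ) :
    boundedSum c b k = ((box c).map fun l => if digitNorm l ≤ b then k l else 0).sum := by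
  induction c generalizing b k with
  | nil => simp [boundedSum, box, digitNorm, listSum]
  | cons c cs ih =>
    have h : boundedSum (c :: cs) b k = listSum (digits c) fun u =>
        cond (Nat.ble (digitSq u) b)
          (boundedSum cs (Nat.sub b (digitSq u)) fun l => k (u :: l)) 0 :=
      rfl
    rw [h, box, sum_map_flatMap, listSum_eq]
    congr 2
    ext u
    rw [ih, List.map_map]
    by_cases hu : digitSq u ≤ b
    · rw [Nat.ble_eq_true_of_le hu, cond_true]
      congr 2
      ext l
      have : digitNorm (u :: l) = digitSq u + digitNorm l := rfl
      simp only [Function.comp_apply, this, Nat.sub_eq]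
      congr 1
      simp only [eq_iff_iff]
      omega
    · have : Nat.ble (digitSq u) b = false := by
        rw [← Bool.not_eq_true, Nat.ble_eq]; exact hu
      rw [this, cond_false, eq_comm, List.sum_eq_zero]
      simp only [List.mem_map, Function.comp_apply, forall_exists_index, and_imp]
      rintro _ l - rfl
      have : digitNorm (u :: l) = digitSq u + digitNorm l := rfl
      rw [if_neg (by omega)]

theorem mem_box {c : List Bool} {l : List ℕ} :
    l ∈ box c ↔ List.Forall₂ (fun u b => u ∈ digits b) l c := by
  induction c generalizing l with
  | nil => simp [box]
  | cons c cs ih =>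
    simp only [box, List.mem_flatMap, List.mem_map, ih, List.forall₂_cons_right_iff]
    grind

theorem nodup_box (c : List Bool) : (box c).Nodup := by
  induction c with
  | nil => simp [box]
  | cons c cs ih =>
    rw [box, List.nodup_flatMap]
    refine ⟨fun u _ => ih.map (List.cons_injective), ?_⟩
    have : (digits c).Nodup := by cases c <;> decide
    refine this.imp ?_
    intro u v huv
    rw [Function.onFun, List.disjoint_left]
    simp only [List.mem_map]
    rintro _ ⟨l, -, rfl⟩ ⟨l', -, h⟩
    exact huv (List.cons_eq_cons.1 h).1.symm

/-- A digit is even exactly when its coordinate is odd, so a list of digits determines its codeword.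
Hence the boxes are disjoint. -/
theorem eq_map_of_mem_box {c : List Bool} {l : List ℕ} (h : l ∈ box c) :
    c = l.map fun u => u % 2 == 0 := by
  rw [mem_box] at h
  induction h with
  | nil => rfl
  | @cons u b l c hu _ ih =>
    rw [List.map_cons, ← ih]
    congr 1
    cases b <;> simp [digits] at hu
    · rcases hu with rfl | rfl | rfl <;> rfl
    · rcases hu with rfl | rfl | rfl | rfl <;> rfl

theorem nodup_boxes : boxes.Nodup := by
  rw [boxes, List.nodup_flatMap]
  refine ⟨fun c _ => nodup_box c, ?_⟩
  have : codewords.Nodup := by decide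
  refine this.imp ?_
  intro c c' hc
  rw [Function.onFun, List.disjoint_left]
  intro l h h'
  exact hc ((eq_map_of_mem_box h).trans (eq_map_of_mem_box h').symm)

/-- The bridge from the pruned recursion, which the kernel can evaluate, to a sum over a finite set.
-/
theorem shortSum_eq (k : List ℕ → ℕ) : shortSum k = ∑ l ∈ shortVectors, k l := by
  rw [shortVectors, Finset.sum_filter, List.sum_toFinset _ nodup_boxes, boxes, sum_map_flatMap,
    shortSum, listSum_eq]
  simp only [boundedSum_eq]

theorem mem_digits {b : Bool} {u : ℕ} : u ∈ digits b ↔ u ≤ 6 ∧ u % 2 = cond b 0 1 := by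
  cases b <;> simp [digits] <;> omega

theorem parity_aux {x y z : ℕ} (h : (x + y + z) % 2 = 1) : x % 2 = (y % 2 + z % 2 + 1) % 2 := by
  omega

/-- The shift by 3 flips the parity in the conditions with three coordinates and keeps it in the one
with four. -/
theorem mem_boxes {l : List ℕ} : l ∈ boxes ↔
    ∃ a b c d e f g : ℕ, l = [a, b, c, d, e, f, g] ∧
      (a ≤ 6 ∧ b ≤ 6 ∧ c ≤ 6 ∧ d ≤ 6 ∧ e ≤ 6 ∧ f ≤ 6 ∧ g ≤ 6) ∧
      (a + c + g) % 2 = 1 ∧ (b + c + f + g) % 2 = 0 ∧ (d + c + f) % 2 = 1 ∧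
        (e + f + g) % 2 = 1 := by
  constructor
  · intro hl
    obtain ⟨C, hC, h⟩ := List.mem_flatMap.1 hl
    rw [mem_box] at h
    simp only [codewords, List.mem_cons, List.not_mem_nil, or_false] at hC
    rcases hC with rfl | rfl | rfl | rfl | rfl | rfl | rfl | rfl
    all_goals
      obtain _ | ⟨ha, _ | ⟨hb, _ | ⟨hc, _ | ⟨hd, _ | ⟨he, _ | ⟨hf, _ | ⟨hg, _ | _⟩⟩⟩⟩⟩⟩⟩ := h
      rw [mem_digits] at ha hb hc hd he hf hg
      simp only [cond_true, cond_false] at ha hb hc hd he hf hg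
      refine ⟨_, _, _, _, _, _, _, rfl,
        ⟨ha.1, hb.1, hc.1, hd.1, he.1, hf.1, hg.1⟩, ?_, ?_, ?_, ?_⟩ <;> omega
  · rintro ⟨a, b, c, d, e, f, g, rfl, ⟨ha, hb, hc, hd, he, hf, hg⟩, h1, h2, h3, h4⟩
    have hdig : ∀ u ≤ 6, u ∈ digits (u % 2 == 0) := by decide
    refine List.mem_flatMap.2 ⟨[a % 2 == 0, b % 2 == 0, c % 2 == 0, d % 2 == 0, e % 2 == 0,
      f % 2 == 0, g % 2 == 0], ?_, mem_box.2 ?_⟩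
    · have k1 := parity_aux h1
      have k2 : b % 2 = (c % 2 + f % 2 + g % 2) % 2 := by clear * - h2; omega
      have k3 := parity_aux h3
      have k4 := parity_aux h4
      rw [k1, k2, k3, k4]
      rcases Nat.mod_two_eq_zero_or_one c with h | h <;>
      rcases Nat.mod_two_eq_zero_or_one f with h' | h' <;>
      rcases Nat.mod_two_eq_zero_or_one g with h'' | h'' <;>
      rw [h, h', h''] <;> decide
    · simp only [List.forall₂_cons, List.Forall₂.nil, and_true]
      exact ⟨hdig a ha, hdig b hb, hdig c hc, hdig d hd, hdig e he, hdig f hf, hdig g hg⟩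

theorem ofDigits_cons (a b c d e f g : ℕ) : ofDigits [a, b, c, d, e, f, g] =
    ![(a : ℤ) - 3, (b : ℤ) - 3, (c : ℤ) - 3, (d : ℤ) - 3, (e : ℤ) - 3, (f : ℤ) - 3,
      (g : ℤ) - 3] := by
  ext i
  fin_cases i <;> rfl

theorem evenCode_ofDigits {l : List ℕ} (hl : l ∈ boxes) : EvenCode (ofDigits l) := by
  obtain ⟨a, b, c, d, e, f, g, rfl, -, h⟩ := mem_boxes.1 hl
  simp only [EvenCode, ofDigits_cons, Matrix.cons_val]
  omega

theorem ofDigits_injOn : Set.InjOn ofDigits {l | l ∈ boxes} := by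
  intro l hl l' hl' h
  obtain ⟨a, b, c, d, e, f, g, rfl, -, -⟩ := mem_boxes.1 hl
  obtain ⟨a', b', c', d', e', f', g', rfl, -, -⟩ := mem_boxes.1 hl'
  simpa [ofDigits_cons] using h

theorem exists_ofDigits {X : Fin 7 → ℤ} (hX : EvenCode X) (h : ∀ i, |X i| ≤ 3) :
    ∃ l ∈ boxes, ofDigits l = X := by
  have h' := fun i => abs_le.1 (h i)
  choose u hu using fun i => Int.eq_ofNat_of_zero_le (a := X i + 3) (by linarith [(h' i).1])
  have hle : ∀ i, u i ≤ 6 := fun i => by have := h' i; have := hu i; omega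
  refine ⟨[u 0, u 1, u 2, u 3, u 4, u 5, u 6], mem_boxes.2 ⟨_, _, _, _, _, _, _, rfl,
    ⟨hle 0, hle 1, hle 2, hle 3, hle 4, hle 5, hle 6⟩, ?_⟩, ?_⟩
  · simp only [EvenCode] at hX
    have := hu 0; have := hu 1; have := hu 2; have := hu 3; have := hu 4; have := hu 5
    have := hu 6
    omega
  · rw [ofDigits_cons]
    ext i
    fin_cases i <;> simp [← hu]

theorem digitSq_cast {u : ℕ} (hu : u ≤ 6) : (digitSq u : ℤ) = ((u : ℤ) - 3) ^ 2 := by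
  interval_cases u <;> rfl

theorem digitNorm_cast {l : List ℕ} (hl : l ∈ boxes) :
    (digitNorm l : ℤ) = ∑ i, ofDigits l i ^ 2 := by
  obtain ⟨a, b, c, d, e, f, g, rfl, ⟨ha, hb, hc, hd, he, hf, hg⟩, -⟩ := mem_boxes.1 hl
  simp only [digitNorm, listSum_eq, List.map_cons, List.map_nil, List.sum_cons, List.sum_nil]
  push_cast
  rw [digitSq_cast ha, digitSq_cast hb, digitSq_cast hc, digitSq_cast hd, digitSq_cast he,
    digitSq_cast hf, digitSq_cast hg, ofDigits_cons, Fin.sum_univ_seven]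
  simp only [Matrix.cons_val]
  ring

/-- The Cayley number encoded by a list of digits. -/
def decode (l : List ℕ) : Cayley := halves (ofDigits l)

theorem decode_mem {l : List ℕ} (hl : l ∈ boxes) : decode l ∈ imIntegral :=
  ⟨halves_mem_integralCayley (evenCode_ofDigits hl), rfl⟩

theorem decode_injOn : Set.InjOn decode {l | l ∈ boxes} := fun _ hl _ hl' h =>
  ofDigits_injOn hl hl' (halves_injective h)

theorem onorm_decode {l : List ℕ} (hl : l ∈ boxes) : onorm (decode l) = digitNorm l / 4 := by
  rw [decode, onorm_halves, ← digitNorm_cast hl, Int.cast_natCast]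

theorem mem_boxes_of_mem_shortVectors {l : List ℕ} (hl : l ∈ shortVectors) : l ∈ boxes :=
  List.mem_toFinset.1 (Finset.mem_filter.1 hl).1

/-- The norm is an integer, hence at most 3. The squares of the doubled coordinates then sum to at
most 12, so each coordinate lies in `[-3, 3]`. -/
theorem exists_decode {x : Cayley} (hx : x ∈ imIntegral) (h : onorm x < 4) :
    ∃ l ∈ shortVectors, decode l = x := by
  obtain ⟨X, hX, rfl⟩ := exists_halves_of_mem hx.1 hx.2
  obtain ⟨n, hn⟩ := exists_int_onorm hx.1
  have hn3 : n ≤ 3 := by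
    rw [hn] at h
    have : n < 4 := by exact_mod_cast h
    omega
  have hs : ∑ i, X i ^ 2 = 4 * n := by
    rw [onorm_halves, div_eq_iff (by norm_num)] at hn
    rw [mul_comm]
    exact_mod_cast hn
  obtain ⟨l, hl, rfl⟩ := exists_ofDigits hX fun i => by
    have := Finset.single_le_sum (f := fun i => X i ^ 2) (fun i _ => sq_nonneg (X i))
      (Finset.mem_univ i)
    rw [abs_le]
    constructor <;> nlinarith
  refine ⟨l, Finset.mem_filter.2 ⟨List.mem_toFinset.2 hl, ?_⟩, rfl⟩
  rw [← digitNorm_cast hl] at hs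
  omega

theorem onorm_decode_lt {l : List ℕ} (hl : l ∈ shortVectors) : onorm (decode l) < 4 := by
  have h := (Finset.mem_filter.1 hl).2
  rw [onorm_decode (mem_boxes_of_mem_shortVectors hl), div_lt_iff₀ (by norm_num)]
  have : (digitNorm l : ℚ) ≤ 12 := by exact_mod_cast h
  linarith

/-! ## Reduction to orbit representatives -/

/-- For each coordinate the weights of the seven digits, as the digits of a number to base `256`. -/
def weightTable : List ℕ :=
  [20638224102553215, 34184276075173455, 33337647828337812, 31644391330307160,
    29951134833069120, 22331480597281317, 35877532573204107]

/-- The total weight of a list of digits, which measures the distance to a representative. -/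
def weight (l : List ℕ) : ℕ :=
  List.rec (fun _ => 0) (fun t _ r l => List.rec 0 (fun u us _ =>
    Nat.add (Nat.mod (Nat.div t (Nat.pow 256 u)) 256) (r us)) l) weightTable l

/-- The matrices in `involutions`, some of them negated, with all entries increased by `2`. -/
def shiftedInvolutions : List (List (List ℕ)) :=
  (List.zipWith (fun (s : ℤ) M => M.map fun r => r.map fun a => Int.toNat (s * a + 2))
    [1, -1, -1, -1, -1, -1, -1, 1, -1, 1, -1] involutions)

/-- The pairing of two lists of numbers. -/
def rowDot (r : List ℕ) (l : List ℕ) : ℕ :=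
  List.rec (fun _ => 0)
    (fun a _ k l => List.rec 0 (fun u us _ => Nat.add (Nat.mul a u) (k us)) l) r l

/-- The code of the image of a vector under a shifted matrix. -/
def moveDigits (M : List (List ℕ)) (l : List ℕ) : List ℕ :=
  M.map fun r => Nat.div (Nat.sub (Nat.add (rowDot r l) 48)
    (Nat.add (Nat.mul 2 (listSum l id)) (Nat.mul 3 (listSum r id)))) 2

/-- The positions of the vanishing coordinates, as a binary number. -/
def zeroPattern (l : List ℕ) : ℕ :=
  List.rec 0 (fun u _ r => Nat.add (cond (Nat.beq u 3) 1 0) (Nat.mul 2 r)) l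

/-- The orbit of a vector under the automorphisms of `𝔬` and `-1`: it is determined by the sum of
squares of the coordinates, except that the vectors with sum of squares `12` form two orbits. -/
def orbitIndex (l : List ℕ) : ℕ :=
  cond (Nat.beq (digitNorm l) 12)
    -- A bit mask over the 128 possible zero patterns: a set bit selects index 13.
    (cond (Nat.beq (Nat.mod (Nat.div 45640383039780254129589716025345
      (Nat.pow 2 (zeroPattern l))) 2) 1) 13 12)
    (digitNorm l)

/-- A representative of an orbit. -/
def representative (n : ℕ) : List ℕ :=
  if n = 0 then [3, 3, 3, 3, 3, 3, 3] else if n = 4 then [3, 3, 3, 3, 3, 1, 3]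
  else if n = 8 then [3, 3, 3, 3, 1, 1, 3] else if n = 12 then [5, 3, 3, 3, 1, 1, 3]
  else [5, 1, 3, 3, 3, 1, 3]

/-- Some involution, up to sign, moves a vector closer to its representative. -/
def canReduce (l : List ℕ) : Bool :=
  shiftedInvolutions.any fun M =>
    Nat.blt (weight (moveDigits M l)) (weight l) &&
      Nat.beq (orbitIndex (moveDigits M l)) (orbitIndex l)

theorem exists_of_mem_shiftedInvolutions : ∀ p ∈ shiftedInvolutions, ∃ M ∈ involutions,
    ∃ s ∈ [(1 : ℤ), -1], (∀ i j, 0 ≤ s * entry M i j + 2) ∧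
      p = List.ofFn fun i => List.ofFn fun j => (s * entry M i j + 2).toNat := by
  decide +kernel

/-- The count of failures is zero: each short vector is its representative, or moves to one of
smaller weight and equal index. The weights and the bit mask need no further justification, and no
orbit has to be determined. -/
theorem shortSum_canReduce :
    shortSum
      (fun l => cond (canReduce l || decide (l = representative (orbitIndex l))) 0 1) = 0 := by
  decide +kernel

theorem rowDot_ofFn (r u : Fin 7 → ℕ) :
    rowDot (List.ofFn r) (List.ofFn u) = ∑ j, r j * u j := by
  simp only [List.ofFn_succ, Fin.sum_univ_succ]
  rfl

theorem moveDigits_eq {M : List (List ℤ)} {s : ℤ} (hs : ∀ i j, 0 ≤ s * entry M i j + 2)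
    {l l' : List ℕ} (hl : l ∈ boxes) (hl' : l' ∈ boxes)
    (h : ∀ i, 2 * ofDigits l' i = s * ∑ j, entry M i j * ofDigits l j) :
    moveDigits (List.ofFn fun i : Fin 7 => List.ofFn fun j : Fin 7 => (s * entry M i j + 2).toNat) l
      = l' := by
  have key : ∀ l ∈ boxes, ∃ u : Fin 7 → ℕ, l = List.ofFn u ∧ ∀ i, ofDigits l i = (u i : ℤ) - 3 := by
    intro l hl
    obtain ⟨a, b, c, d, e, f, g, rfl, -⟩ := mem_boxes.1 hl
    refine ⟨![a, b, c, d, e, f, g], by simp, fun i => ?_⟩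
    rw [ofDigits_cons]
    fin_cases i <;> rfl
  obtain ⟨u, rfl, hu⟩ := key l hl
  obtain ⟨u', rfl, hu'⟩ := key l' hl'
  simp only [hu, hu'] at h
  rw [moveDigits, List.map_ofFn]
  congr 1
  ext i
  have hr : ∀ v : Fin 7 → ℕ, listSum (List.ofFn v) id = ∑ j, v j := fun v => by
    simp [listSum_eq, Fin.sum_univ_succ]
  simp only [Function.comp_apply, rowDot_ofFn, hr, Nat.add_eq, Nat.sub_eq, Nat.mul_eq]
  have h2 := h i
  have e1 : ((∑ j, (s * entry M i j + 2).toNat * u j : ℕ) : ℤ) =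
      s * (∑ j, entry M i j * u j) + 2 * ∑ j, (u j : ℤ) := by
    push_cast
    simp only [Int.toNat_of_nonneg (hs i _), Finset.mul_sum, ← Finset.sum_add_distrib]
    exact Finset.sum_congr rfl fun j _ => by ring
  have e2 : ((∑ j, (s * entry M i j + 2).toNat : ℕ) : ℤ) = s * (∑ j, entry M i j) + 14 := by
    push_cast
    simp only [Int.toNat_of_nonneg (hs i _), Finset.mul_sum, Finset.sum_add_distrib]
    simp
  have e3 : ∑ j, entry M i j * ((u j : ℤ) - 3) =
      ∑ j, entry M i j * u j - 3 * ∑ j, entry M i j := by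
    simp only [mul_sub, Finset.sum_sub_distrib, Finset.mul_sum]
    simp only [mul_comm]
  rw [e3] at h2
  -- Here 48 = 3 · 14 + 6: seven entries shifted by 2 give 14, multiplied by the digit shift 3, and
  -- the doubled digit of the image contributes 6.
  have : ∑ j, (s * entry M i j + 2).toNat * u j + 48 =
      2 * ∑ j, u j + 3 * ∑ j, (s * entry M i j + 2).toNat + 2 * u' i := by
    zify at e1 e2 ⊢
    rw [e1, e2]
    linarith
  change _ / 2 = _
  omega

theorem exists_decode_moveDigits {p : List (List ℕ)} (hp : p ∈ shiftedInvolutions) {l : List ℕ}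
    (hl : l ∈ shortVectors) : moveDigits p l ∈ shortVectors ∧ ∀ d,
      (fiber (decode (moveDigits p l)) d).ncard = (fiber (decode l) d).ncard := by
  obtain ⟨M, hM, s, hs, h0, rfl⟩ := exists_of_mem_shiftedInvolutions p hp
  have hlb := mem_boxes_of_mem_shortVectors hl
  have hg := isInvolution_halfMul hM
  have hs' : ∃ x ∈ imIntegral, (onorm x < 4 ∧
      ∀ d, (fiber x d).ncard = (fiber (decode l) d).ncard) ∧
        x = (s : ℚ) • halfMul M (decode l) := by
    have hm := hg.map_mem (decode_mem hlb)
    have hn : onorm (halfMul M (decode l)) < 4 := by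
      rw [hg.onorm_map]; exact onorm_decode_lt hl
    simp only [List.mem_cons, List.not_mem_nil, or_false] at hs
    rcases hs with rfl | rfl
    · exact ⟨_, hm, ⟨hn, hg.ncard_fiber _⟩, by simp⟩
    · exact ⟨_, neg_mem_imIntegral hm, ⟨by rwa [onorm_neg], fun d => by
        rw [ncard_fiber_neg, hg.ncard_fiber]⟩, by simp⟩
  obtain ⟨x, hx, ⟨hn, hf⟩, hxe⟩ := hs'
  obtain ⟨l', hl', rfl⟩ := exists_decode hx hn
  rw [moveDigits_eq h0 hlb (mem_boxes_of_mem_shortVectors hl')]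
  · exact ⟨hl', hf⟩
  · intro i
    have := congrFun hxe i.succ
    simp only [decode, halves, halfMul, Pi.smul_apply, Fin.cons_succ, smul_eq_mul,
      mul_div_assoc', ← Finset.sum_div] at this
    rw [← @Int.cast_inj ℚ]
    push_cast
    linarith

/-- Descent on the weight: each move preserves the fiber cardinality and the index. -/
theorem ncard_fiber_representative {l : List ℕ} (hl : l ∈ shortVectors) (d : ℚ) :
    (fiber (decode l) d).ncard = (fiber (decode (representative (orbitIndex l))) d).ncard := by
  induction hw : weight l using Nat.strong_induction_on generalizing l with
  | _ w ih =>
    have h := shortSum_canReduce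
    rw [shortSum_eq, Finset.sum_eq_zero_iff] at h
    have h := h l hl
    rcases Bool.eq_false_or_eq_true (canReduce l) with hc | hc
    · obtain ⟨p, hp, h2⟩ := List.any_eq_true.1 hc
      rw [Bool.and_eq_true, Nat.beq_eq, Nat.blt_eq] at h2
      obtain ⟨hm, hf⟩ := exists_decode_moveDigits hp hl
      rw [← hf, ih _ (hw ▸ h2.1) hm rfl, h2.2]
    · rw [hc, Bool.false_or] at h
      by_cases he : l = representative (orbitIndex l)
      · rw [← he]
      · simp [he] at h

/-! ## Reading off multiplicities from a number -/

/-- With fewer than `B` terms no carries occur: exponents below `j` contribute less than `B ^ j`,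
and those above `j` a multiple of `B ^ (j + 1)`. -/
theorem sum_pow_div_mod {ι : Type*} (s : Finset ι) (e : ι → ℕ) {B : ℕ} (hB : s.card < B) (j : ℕ) :
    (∑ i ∈ s, B ^ e i) / B ^ j % B = (s.filter fun i => e i = j).card := by
  classical
  have hB0 : 0 < B := by omega
  have h1 : ∑ i ∈ s, B ^ e i = ∑ i ∈ s.filter (fun i => e i < j), B ^ e i +
      (∑ i ∈ s.filter (fun i => e i = j), B ^ e i +
        ∑ i ∈ s.filter (fun i => j < e i), B ^ e i) := by
    rw [Finset.sum_filter, Finset.sum_filter, Finset.sum_filter, ← Finset.sum_add_distrib,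
      ← Finset.sum_add_distrib]
    refine Finset.sum_congr rfl fun i _ => ?_
    rcases lt_trichotomy (e i) j with h | h | h
    · simp [h, h.ne, h.not_gt]
    · simp [h]
    · simp [h, h.ne', h.not_gt]
  have h2 : ∑ i ∈ s.filter (fun i => e i < j), B ^ e i < B ^ j := by
    rcases Nat.eq_zero_or_pos j with rfl | hj
    · simp
    · calc ∑ i ∈ s.filter (fun i => e i < j), B ^ e i
          ≤ ∑ i ∈ s.filter (fun i => e i < j), B ^ (j - 1) :=
            Finset.sum_le_sum fun i hi => Nat.pow_le_pow_right hB0 (by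
              have := (Finset.mem_filter.1 hi).2; omega)
        _ = (s.filter (fun i => e i < j)).card * B ^ (j - 1) := by simp
        _ ≤ s.card * B ^ (j - 1) := Nat.mul_le_mul_right _ (Finset.card_filter_le _ _)
        _ < B * B ^ (j - 1) := Nat.mul_lt_mul_of_pos_right hB (by positivity)
        _ = B ^ j := by rw [← pow_succ', Nat.sub_add_cancel hj]
  have h3 : ∑ i ∈ s.filter (fun i => e i = j), B ^ e i =
      B ^ j * (s.filter fun i => e i = j).card := by
    rw [Finset.sum_congr rfl fun i hi => by rw [(Finset.mem_filter.1 hi).2], Finset.sum_const,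
      smul_eq_mul, mul_comm]
  obtain ⟨K, hK⟩ : B ^ (j + 1) ∣ ∑ i ∈ s.filter (fun i => j < e i), B ^ e i :=
    Finset.dvd_sum fun i hi => pow_dvd_pow _ (Finset.mem_filter.1 hi).2
  rw [h1, h3, hK, pow_succ, mul_assoc, ← mul_add, Nat.add_mul_div_left _ _ (by positivity),
    Nat.div_eq_of_lt h2, zero_add, Nat.add_mul_mod_self_left, Nat.mod_eq_of_lt]
  exact (Finset.card_filter_le _ _).trans_lt hB

theorem mod_pow_div_mod (P : ℕ) {B j m : ℕ} (hj : j < m) :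
    P % B ^ m / B ^ j % B = P / B ^ j % B := by
  obtain ⟨t, rfl⟩ := Nat.exists_eq_add_of_lt hj
  rw [show B ^ (j + t + 1) = B ^ j * B ^ (t + 1) by ring, Nat.mod_mul_right_div_self, pow_succ',
    Nat.mod_mul_right_mod]

/-! ## The generating function -/

/-- The exponent contributed by a pair of digits. -/
def expTerm (u w : ℕ) : ℕ :=
  Nat.sub (Nat.add (Nat.add (Nat.mul u u) (Nat.mul 3 u)) (Nat.add (Nat.mul 3 w) 3)) (Nat.mul u w)

/-- The generating function of `expTerm` over the digits of given parity, at `2 ^ 40`. -/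
def theta (c : Bool) (w : ℕ) : ℕ :=
  listSum (digits c) fun u => Nat.pow 1099511627776 (expTerm u w)

/-- The sum over `codewords` of the products of entries chosen according to the codeword. -/
def codeSum (a a' b b' c c' d d' e e' f f' g g' : ℕ) : ℕ :=
  Nat.add
    (Nat.add
      (Nat.mul (Nat.mul (Nat.mul c d) f)
        (Nat.add (Nat.mul (Nat.mul a b) (Nat.mul e g)) (Nat.mul (Nat.mul a' b') (Nat.mul e' g'))))
      (Nat.mul (Nat.mul (Nat.mul c' d') f)
        (Nat.add (Nat.mul (Nat.mul a' b') (Nat.mul e g)) (Nat.mul (Nat.mul a b) (Nat.mul e' g')))))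
    (Nat.add
      (Nat.mul (Nat.mul (Nat.mul c d') f')
        (Nat.add (Nat.mul (Nat.mul a b') (Nat.mul e' g)) (Nat.mul (Nat.mul a' b) (Nat.mul e g'))))
      (Nat.mul (Nat.mul (Nat.mul c' d) f')
        (Nat.add (Nat.mul (Nat.mul a' b) (Nat.mul e' g)) (Nat.mul (Nat.mul a b') (Nat.mul e g')))))

/-- The generating function of `expTerm` over `boxes`, at `2 ^ 40`. -/
def thetaSum : List ℕ → ℕ
  | [a, b, c, d, e, f, g] =>
    codeSum (theta false a) (theta true a) (theta false b) (theta true b) (theta false c)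
      (theta true c) (theta false d) (theta true d) (theta false e) (theta true e)
      (theta false f) (theta true f) (theta false g) (theta true g)
  | _ => 0

/-- For an orbit representative with doubled coordinates `X` and a vector with doubled coordinates
`Y`, the coordinates of `-(X × Y) / 2`, increased by `9`. -/
def crossIndex (n : ℕ) : List ℕ → List ℕ
  | [a, b, c, d, e, f, g] =>
    if n = 0 then [9, 9, 9, 9, 9, 9, 9]
    else if n = 4 then [12 - e, 6 + g, 12 - d, 6 + c, 6 + a, 9, 12 - b]
    else if n = 8 then [9 + f - e, 9 + g - c, 9 + b - d, 3 + c + g, 6 + a, 12 - a, 15 - b - d]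
    else if n = 12 then [9 + f - e, 6 + d + g - c, 6 + b + g - d, 6 + c + g - b, 3 + a + f,
      15 - a - e, 18 - b - c - d]
    else [9 + d - e, 3 + d + g, 12 + g - d - e, 12 + c - a - b, a + c + f, 15 - e - g,
      12 + f - b - c]
  | _ => []

/-- The exponent attached to a pair of vectors. -/
def pairExp (n : ℕ) (y z : List ℕ) : ℕ :=
  digitNorm (representative n) + digitNorm y + (List.zipWith expTerm z (crossIndex n y)).sum

/-- The generating function of `pairExp`, at `2 ^ 40`. -/
def genSum (n : ℕ) : ℕ :=
  shortSum fun y => Nat.mul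
    (Nat.pow 1099511627776 (Nat.add (digitNorm (representative n)) (digitNorm y)))
    (thetaSum (crossIndex n y))

/-- The multiplicities of twice the determinant, for given orbit representatives. -/
def multiplicities (n : ℕ) : List (ℕ × ℕ) :=
  if n = 0 then [(4, 194656), (8, 17388), (12, 252), (16, 1)]
  else if n = 4 then [(2, 74432), (4, 20880), (6, 3648), (8, 312), (12, 1)]
  else if n = 8 then [(2, 11328), (4, 1224), (8, 1)]
  else if n = 12 then [(2, 120), (4, 1)]
  else [(2, 144), (4, 1)]

/-- The multiplicity of a given value of twice the determinant. -/
def multiplicity (n D : ℕ) : ℕ := listSum (multiplicities n) fun p => cond (Nat.beq p.1 D) p.2 0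

/-- The main computation. The exponent of a pair is `163 - 2 det`, so reducing modulo the power 163
keeps exactly the pairs of positive determinant. -/
theorem genSum_mod : ∀ n ∈ [0, 4, 8, 12, 13], Nat.mod (genSum n) (Nat.pow 1099511627776 163) =
    listSum (multiplicities n) fun p => Nat.mul p.2 (Nat.pow 1099511627776 (Nat.sub 163 p.1)) := by
  decide +kernel

theorem multiplicity_eq : ∀ n ∈ [0, 4, 8, 12, 13], ∀ D ∈ List.range 163,
    Nat.mod (Nat.div (listSum (multiplicities n) fun p =>
      Nat.mul p.2 (Nat.pow 1099511627776 (Nat.sub 163 p.1)))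
      (Nat.pow 1099511627776 (Nat.sub 162 D)))
        1099511627776 = multiplicity n (D + 1) := by
  decide +kernel

/-- The exponent is additive over coordinates and a box is a product of digit sets, so the sum
factors. -/
theorem sum_map_box (c : List Bool) (w : List ℕ) (h : w.length = c.length) :
    ((box c).map fun z => 1099511627776 ^ (List.zipWith expTerm z w).sum).sum =
      (List.zipWith theta c w).prod := by
  induction c generalizing w with
  | nil => simp [box]
  | cons c cs ih =>
    obtain _ | ⟨w, ws⟩ := w
    · simp at h
    · rw [box, sum_map_flatMap, List.zipWith_cons_cons, List.prod_cons, ← ih ws (by simpa using h),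
        theta, listSum_eq, ← List.sum_map_mul_right]
      congr 2
      ext u
      rw [List.map_map, ← List.sum_map_mul_left]
      congr 2
      ext z
      simp [pow_add]

theorem thetaSum_eq (W : Fin 7 → ℕ) : thetaSum (List.ofFn W) =
    ∑ z ∈ boxes.toFinset, 1099511627776 ^ (List.zipWith expTerm z (List.ofFn W)).sum := by
  have h : ∀ c ∈ codewords, c.length = 7 := by decide
  rw [List.sum_toFinset _ nodup_boxes, boxes, sum_map_flatMap, List.map_congr_left (fun c hc =>
    sum_map_box c (List.ofFn W) (by rw [h c hc, List.length_ofFn]))]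
  simp only [List.ofFn_succ, List.ofFn_zero, codewords, List.map_cons, List.map_nil,
    List.zipWith_cons_cons, List.zipWith_nil_left, List.prod_cons, List.prod_nil, List.sum_cons,
    List.sum_nil, thetaSum, codeSum, Nat.add_eq, Nat.mul_eq]
  ring

/-! ## Multiplicities of the determinant over a fixed entry -/

/-- Minus the cross product of two purely imaginary octonions. -/
def crossForm (X Y : Fin 7 → ℤ) : Fin 7 → ℤ :=
  ![X 5 * Y 4 - X 4 * Y 5 + (X 3 * Y 1 - X 1 * Y 3) + (X 6 * Y 2 - X 2 * Y 6),
    X 6 * Y 5 - X 5 * Y 6 + (X 4 * Y 2 - X 2 * Y 4) + (X 0 * Y 3 - X 3 * Y 0),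
    X 0 * Y 6 - X 6 * Y 0 + (X 5 * Y 3 - X 3 * Y 5) + (X 1 * Y 4 - X 4 * Y 1),
    X 1 * Y 0 - X 0 * Y 1 + (X 6 * Y 4 - X 4 * Y 6) + (X 2 * Y 5 - X 5 * Y 2),
    X 2 * Y 1 - X 1 * Y 2 + (X 0 * Y 5 - X 5 * Y 0) + (X 3 * Y 6 - X 6 * Y 3),
    X 3 * Y 2 - X 2 * Y 3 + (X 1 * Y 6 - X 6 * Y 1) + (X 4 * Y 0 - X 0 * Y 4),
    X 4 * Y 3 - X 3 * Y 4 + (X 2 * Y 0 - X 0 * Y 2) + (X 5 * Y 1 - X 1 * Y 5)]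

theorem halves_eq (X : Fin 7 → ℤ) :
    halves X = ![(0 : ℚ), X 0 / 2, X 1 / 2, X 2 / 2, X 3 / 2, X 4 / 2, X 5 / 2, X 6 / 2] := by
  ext i
  fin_cases i <;> rfl

theorem otrace_halves (X Y Z : Fin 7 → ℤ) :
    otrace (omul (omul (halves X) (halves Z)) (oconj (halves Y))) =
      (∑ i, crossForm X Y i * Z i : ℤ) / 4 := by
  rw [← oinner_omul]
  simp only [halves_eq, oinner, Fin.sum_univ_eight, Fin.sum_univ_seven, omul, crossForm,
    Matrix.cons_val]
  push_cast
  ring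

theorem det_halves (X Y Z : Fin 7 → ℤ) : 2 * (twoDiag (halves X) (halves Y) (halves Z)).det =
    (16 - ∑ i, X i ^ 2 - ∑ i, Y i ^ 2 - ∑ i, Z i ^ 2 : ℤ) +
      (∑ i, crossForm X Y i * Z i : ℤ) / 2 := by
  rw [det_twoDiag, otrace_halves, onorm_halves, onorm_halves, onorm_halves]
  push_cast
  ring

theorem representative_mem_boxes (n : ℕ) : representative n ∈ boxes := by
  rw [mem_boxes]
  unfold representative
  split_ifs <;> exact ⟨_, _, _, _, _, _, _, rfl, by decide⟩

theorem representative_mem (n : ℕ) : representative n ∈ shortVectors := by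
  refine Finset.mem_filter.2 ⟨List.mem_toFinset.2 (representative_mem_boxes n), ?_⟩
  unfold representative
  split_ifs <;> decide

/-- Representatives have doubled coordinates 0 and ±2, so the cross product can be halved. The
bounds on the digits keep the natural-number subtractions from truncating. -/
theorem exists_crossIndex (n : ℕ) {y : List ℕ} (hy : y ∈ boxes) :
    ∃ W : Fin 7 → ℕ, crossIndex n y = List.ofFn W ∧ ∀ i, W i ≤ 18 ∧
      2 * ((W i : ℤ) - 9) = crossForm (ofDigits (representative n)) (ofDigits y) i := by
  obtain ⟨a, b, c, d, e, f, g, rfl, ⟨ha, hb, hc, hd, he, hf, hg⟩, -⟩ := mem_boxes.1 hy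
  have key : ∀ w0 w1 w2 w3 w4 w5 w6 : ℕ, (∀ i, (![w0, w1, w2, w3, w4, w5, w6] i) ≤ 18 ∧
      2 * ((![w0, w1, w2, w3, w4, w5, w6] i : ℕ) - 9 : ℤ) =
        crossForm (ofDigits (representative n)) (ofDigits [a, b, c, d, e, f, g]) i) →
      ∃ W : Fin 7 → ℕ, [w0, w1, w2, w3, w4, w5, w6] = List.ofFn W ∧ ∀ i, W i ≤ 18 ∧
      2 * ((W i : ℤ) - 9) =
        crossForm (ofDigits (representative n)) (ofDigits [a, b, c, d, e, f, g]) i :=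
    fun w0 w1 w2 w3 w4 w5 w6 h => ⟨![w0, w1, w2, w3, w4, w5, w6], by simp, h⟩
  unfold representative at key ⊢
  unfold crossIndex
  split_ifs at key ⊢
  all_goals
    refine key _ _ _ _ _ _ _ fun i => ?_
    rw [ofDigits_cons, ofDigits_cons]
    fin_cases i <;> simp [crossForm] <;> omega

/-- The shift 21 keeps each term non-negative on the given ranges. Seven shifts and the constant 16
of `2 det` add up to the offset 163. -/
theorem expTerm_cast {u w : ℕ} (hu : u ≤ 6) (hw : w ≤ 18) :
    (expTerm u w : ℤ) = ((u : ℤ) - 3) ^ 2 - ((u : ℤ) - 3) * ((w : ℤ) - 9) + 21 := by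
  have h : u * w ≤ u * u + 3 * u + (3 * w + 3) := by
    interval_cases u <;> omega
  simp only [expTerm, Nat.add_eq, Nat.sub_eq, Nat.mul_eq]
  push_cast [Nat.cast_sub h]
  ring

theorem pairExp_cast (n : ℕ) {y z : List ℕ} (hy : y ∈ boxes) (hz : z ∈ boxes) :
    (pairExp n y z : ℚ) =
      163 - 2 * (twoDiag (decode (representative n)) (decode y) (decode z)).det := by
  rw [decode, decode, decode, det_halves, ← digitNorm_cast hy,
    ← digitNorm_cast (representative_mem_boxes n)]
  obtain ⟨W, hW, h⟩ := exists_crossIndex n hy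
  simp only [← (h _).2]
  obtain ⟨a, b, c, d, e, f, g, rfl, ⟨ha, hb, hc, hd, he, hf, hg⟩, -⟩ := mem_boxes.1 hz
  have hs : (((List.zipWith expTerm [a, b, c, d, e, f, g] (List.ofFn W)).sum : ℕ) : ℤ) =
      ∑ i, ofDigits [a, b, c, d, e, f, g] i ^ 2 -
        ∑ i, ((W i : ℤ) - 9) * ofDigits [a, b, c, d, e, f, g] i + 147 := by
    rw [ofDigits_cons]
    simp only [List.ofFn_succ, List.zipWith_cons_cons, List.sum_cons, List.ofFn_zero,
      List.zipWith_nil_left, List.sum_nil, Fin.sum_univ_seven, Matrix.cons_val]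
    push_cast
    rw [expTerm_cast ha (h _).1, expTerm_cast hb (h _).1, expTerm_cast hc (h _).1,
      expTerm_cast hd (h _).1, expTerm_cast he (h _).1, expTerm_cast hf (h _).1,
      expTerm_cast hg (h _).1]
    ring
  rw [pairExp, hW]
  generalize (List.zipWith expTerm [a, b, c, d, e, f, g] (List.ofFn W)).sum = N at hs ⊢
  have hs' := congrArg (Int.cast (R := ℚ)) hs
  simp only [mul_assoc, ← Finset.mul_sum]
  push_cast at hs' ⊢
  rw [hs']
  ring

theorem genSum_eq (n : ℕ) : genSum n =
    ∑ p ∈ shortVectors ×ˢ boxes.toFinset, 1099511627776 ^ pairExp n p.1 p.2 := by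
  rw [genSum, shortSum_eq, Finset.sum_product]
  refine Finset.sum_congr rfl fun y hy => ?_
  obtain ⟨W, hW, -⟩ := exists_crossIndex n (mem_boxes_of_mem_shortVectors hy)
  simp only [pairExp, hW, thetaSum_eq, Nat.mul_eq, Nat.pow_eq, Nat.add_eq, Finset.mul_sum, pow_add]

theorem length_box (c : List Bool) : (box c).length ≤ 4 ^ c.length := by
  induction c with
  | nil => simp [box]
  | cons c cs ih =>
    have : (digits c).length ≤ 4 := by cases c <;> decide
    simp only [box, List.length_flatMap, List.length_map, List.map_const', List.sum_replicate,
      smul_eq_mul, List.length_cons, pow_succ']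
    exact Nat.mul_le_mul this ih

theorem card_boxes_le : boxes.toFinset.card ≤ 131072 := by
  have h : ∀ c ∈ codewords, (box c).length ≤ 16384 := fun c hc => by
    have h7 : ∀ c ∈ codewords, c.length = 7 := by decide
    have := length_box c
    rwa [h7 c hc] at this
  refine (List.toFinset_card_le _).trans ?_
  rw [boxes, List.length_flatMap]
  refine (List.sum_le_card_nsmul _ 16384 ?_).trans ?_
  · simpa using h
  · simp [codewords]

/-- The crude bound of `2 ^ 17` vectors gives at most `2 ^ 34` pairs, below the base `2 ^ 40`. -/
theorem card_pairs_lt : (shortVectors ×ˢ boxes.toFinset).card < 1099511627776 := by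
  rw [Finset.card_product]
  have h1 : shortVectors.card ≤ 131072 := (Finset.card_filter_le _ _).trans card_boxes_le
  have := Nat.mul_le_mul h1 card_boxes_le
  omega

theorem card_pairs (n : ℕ) (hn : n ∈ [0, 4, 8, 12, 13]) {D : ℕ} (hD : 1 ≤ D) (hD' : D ≤ 163) :
    ((shortVectors ×ˢ boxes.toFinset).filter fun p => pairExp n p.1 p.2 = 163 - D).card =
      multiplicity n D := by
  obtain ⟨D, rfl⟩ := Nat.exists_eq_add_of_le' hD
  rw [← multiplicity_eq n hn D (List.mem_range.2 (by omega)), ← genSum_mod n hn,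
    ← sum_pow_div_mod _ (fun p : List ℕ × List ℕ => pairExp n p.1 p.2) card_pairs_lt, ← genSum_eq,
    ← mod_pow_div_mod (genSum n) (show 163 - (D + 1) < 163 by omega)]
  rw [show 163 - (D + 1) = 162 - D by omega]
  rfl

-- Pairs `(y, z)` with exponent `163 - D` correspond to the fiber; `z` is automatically short
-- because the determinant is positive.
set_option linter.constructorNameAsVariable false in
theorem ncard_fiber_decode_representative {n : ℕ} (hn : n ∈ [0, 4, 8, 12, 13]) {D : ℕ}
    (hD : 1 ≤ D) (hD' : D ≤ 163) :
    (fiber (decode (representative n)) (D / 2)).ncard = multiplicity n D := by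
  rw [← card_pairs n hn hD hD', ← Set.ncard_coe_finset]
  symm
  refine Set.ncard_congr
    (fun p _ => twoDiag (decode (representative n)) (decode p.1) (decode p.2)) ?_ ?_ ?_
  · rintro ⟨y, z⟩ hp
    simp only [Finset.coe_filter, Finset.mem_product, List.mem_toFinset, Set.mem_ofPred_eq] at hp
    obtain ⟨⟨hy, hz⟩, he⟩ := hp
    have hyb := mem_boxes_of_mem_shortVectors hy
    have h := pairExp_cast n hyb hz
    have hd : (twoDiag (decode (representative n)) (decode y) (decode z)).det = D / 2 := by
      rw [he, Nat.cast_sub hD'] at h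
      push_cast at h
      linarith
    have hpos : 0 < (twoDiag (decode (representative n)) (decode y) (decode z)).det := by
      rw [hd]
      have : (1 : ℚ) ≤ D := by exact_mod_cast hD
      linarith
    have hx := onorm_decode_lt (representative_mem n)
    exact ⟨twoDiag_mem_posTwo.2 ⟨⟨decode_mem (representative_mem_boxes n), decode_mem hyb,
      decode_mem hz⟩, hx, onorm_decode_lt hy, onorm_lt_four_of_det_pos hx hpos, hpos⟩, rfl, hd⟩
  · rintro ⟨y, z⟩ ⟨y', z'⟩ hp hp' h
    simp only [Finset.coe_filter, Finset.mem_product, List.mem_toFinset, Set.mem_ofPred_eq]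
      at hp hp'
    simp only [twoDiag, Jordan.mk.injEq, true_and] at h
    rw [decode_injOn (mem_boxes_of_mem_shortVectors hp.1.1)
      (mem_boxes_of_mem_shortVectors hp'.1.1) h.1, decode_injOn hp.1.2 hp'.1.2 h.2]
  · rintro T ⟨hT, hx, hd⟩
    obtain ⟨x, -, y, hy, z, hz, rfl, -, hy4, hz4, -⟩ := mem_posTwo.1 hT
    obtain rfl : x = decode (representative n) := hx
    obtain ⟨y, hy', rfl⟩ := exists_decode hy hy4
    obtain ⟨z, hz', rfl⟩ := exists_decode hz hz4
    have hzb := mem_boxes_of_mem_shortVectors hz'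
    refine ⟨(y, z), ?_, rfl⟩
    simp only [Finset.coe_filter, Finset.mem_product, List.mem_toFinset, Set.mem_ofPred_eq]
    refine ⟨⟨hy', hzb⟩, ?_⟩
    have h := pairExp_cast n (mem_boxes_of_mem_shortVectors hy') hzb
    rw [hd] at h
    have : ((pairExp n y z + D : ℕ) : ℚ) = (163 : ℕ) := by
      push_cast
      linarith
    have := Nat.cast_injective this
    omega

/-! ## Multiplicities of the determinant -/

/-- Any other index falls into the default branches, so it is unnecessary to show that only the five
indices occur. -/
theorem representative_eq_thirteen {n : ℕ} (hn : n ∉ [0, 4, 8, 12, 13]) :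
    representative n = representative 13 ∧ ∀ D, multiplicity n D = multiplicity 13 D := by
  simp only [List.mem_cons, List.not_mem_nil, or_false, not_or] at hn
  simp [representative, multiplicity, multiplicities, hn]

set_option linter.constructorNameAsVariable false in
theorem ncard_fiber_decode {l : List ℕ} (hl : l ∈ shortVectors) {D : ℕ} (hD : 1 ≤ D)
    (hD' : D ≤ 163) : (fiber (decode l) (D / 2)).ncard = multiplicity (orbitIndex l) D := by
  rw [ncard_fiber_representative hl]
  by_cases hn : orbitIndex l ∈ [0, 4, 8, 12, 13]
  · exact ncard_fiber_decode_representative hn hD hD'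
  · rw [(representative_eq_thirteen hn).1, (representative_eq_thirteen hn).2]
    exact ncard_fiber_decode_representative (by decide) hD hD'

theorem finite_posTwo : posTwo.Finite := by
  refine ((shortVectors ×ˢ shortVectors ×ˢ shortVectors).finite_toSet.image
    fun p => twoDiag (decode p.1) (decode p.2.1) (decode p.2.2)).subset ?_
  intro T hT
  obtain ⟨x, hx, y, hy, z, hz, rfl, hx4, hy4, hz4, -⟩ := mem_posTwo.1 hT
  obtain ⟨x, hx', rfl⟩ := exists_decode hx hx4
  obtain ⟨y, hy', rfl⟩ := exists_decode hy hy4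
  obtain ⟨z, hz', rfl⟩ := exists_decode hz hz4
  exact ⟨(x, y, z), by simp [hx', hy', hz'], rfl⟩

theorem finite_fiber (x : Cayley) (d : ℚ) : (fiber x d).Finite :=
  finite_posTwo.subset fun _ h => h.1

theorem exists_det_eq {T : Jordan} (hT : T ∈ posTwo) :
    ∃ D : ℕ, D ∈ [2, 4, 6, 8, 12, 16] ∧ T.det = D / 2 := by
  obtain ⟨x, hx, y, hy, z, hz, rfl, hx4, hy4, hz4, hpos⟩ := mem_posTwo.1 hT
  obtain ⟨l, hl, rfl⟩ := exists_decode hx hx4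
  set d := (twoDiag (decode l) y z).det with hd
  have h1 : (fiber (decode l) d).ncard ≠ 0 :=
    (Set.ncard_pos (finite_fiber _ _)).2 ⟨_, hT, rfl, rfl⟩ |>.ne'
  -- The fiber over the representative is non-empty for the same determinant, and there `163 - 2
  -- det` is a natural number, less than 163 by positivity.
  obtain ⟨D, hD, hD', he⟩ : ∃ D : ℕ, 1 ≤ D ∧ D ≤ 163 ∧ d = D / 2 := by
    have h2 := h1
    rw [ncard_fiber_representative hl] at h2
    obtain ⟨T', hT', hx', hd'⟩ := Set.nonempty_of_ncard_ne_zero h2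
    obtain ⟨x', -, y', hy', z', hz', rfl, -, hy4', hz4', -⟩ := mem_posTwo.1 hT'
    obtain rfl : x' = _ := hx'
    obtain ⟨ly, hly, rfl⟩ := exists_decode hy' hy4'
    obtain ⟨lz, hlz, rfl⟩ := exists_decode hz' hz4'
    have h := pairExp_cast (orbitIndex l) (mem_boxes_of_mem_shortVectors hly)
      (mem_boxes_of_mem_shortVectors hlz)
    rw [hd'] at h
    generalize pairExp (orbitIndex l) ly lz = e at h
    have he : (e : ℚ) < (163 : ℕ) := by push_cast; linarith
    have he' : e < 163 := by exact_mod_cast he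
    refine ⟨163 - e, by omega, by omega, ?_⟩
    rw [Nat.cast_sub he'.le, h]
    push_cast
    ring
  refine ⟨D, ?_, he⟩
  rw [he, ncard_fiber_decode hl hD hD'] at h1
  contrapose! h1
  simp only [List.mem_cons, List.not_mem_nil, or_false, not_or] at h1
  have hb : ∀ k, D ≠ k → Nat.beq k D = false := fun k hk => by
    rw [← Bool.not_eq_true, Nat.beq_eq]
    exact hk.symm
  unfold multiplicity multiplicities
  split_ifs <;> simp [listSum_eq, hb, h1]

theorem shortSum_multiplicity : ∀ p ∈ [(2, 18192384), (4, 3752952), (6, 459648), (8, 57456),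
    (12, 378), (16, 1)], shortSum (fun l => multiplicity (orbitIndex l) p.1) = p.2 := by
  decide +kernel

theorem shortSum_norm_two : shortSum (fun l => cond (Nat.beq (digitNorm l) 8) 1 0) = 756 := by
  decide +kernel

set_option linter.constructorNameAsVariable false in
theorem ncard_det_eq {D n : ℕ} (h : (D, n) ∈ [(2, 18192384), (4, 3752952), (6, 459648),
    (8, 57456), (12, 378), (16, 1)]) : {T ∈ posTwo | T.det = D / 2}.ncard = n := by
  classical
  have hD : 1 ≤ D ∧ D ≤ 163 := by
    simp only [List.mem_cons, Prod.mk.injEq, List.not_mem_nil, or_false] at h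
    omega
  have hs := shortSum_multiplicity _ h
  dsimp only at hs
  rw [shortSum_eq] at hs
  rw [← hs]
  have hfin : {T ∈ posTwo | T.det = D / 2}.Finite := finite_posTwo.subset fun _ h => h.1
  have hU : {T ∈ posTwo | T.det = (D : ℚ) / 2} =
      ⋃ l ∈ shortVectors, fiber (decode l) (D / 2) := by
    ext T
    simp only [Set.mem_iUnion, exists_prop]
    constructor
    · rintro ⟨hT, hd⟩
      obtain ⟨x, hx, y, hy, z, hz, rfl, hx4, -⟩ := mem_posTwo.1 hT
      obtain ⟨l, hl, rfl⟩ := exists_decode hx hx4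
      exact ⟨l, hl, hT, rfl, hd⟩
    · rintro ⟨l, -, hT, -, hd⟩
      exact ⟨hT, hd⟩
  rw [hU, ← Finset.sum_congr rfl fun l hl => ncard_fiber_decode hl hD.1 hD.2]
  have hdis : (shortVectors : Set (List ℕ)).PairwiseDisjoint
      fun l => (finite_fiber (decode l) (D / 2)).toFinset := by
    intro l hl l' hl' hne
    rw [Function.onFun, Finset.disjoint_left]
    intro T h1 h2
    rw [Set.Finite.mem_toFinset] at h1 h2
    exact hne (decode_injOn (mem_boxes_of_mem_shortVectors hl) (mem_boxes_of_mem_shortVectors hl')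
      (h1.2.1.symm.trans h2.2.1))
  rw [show (⋃ l ∈ shortVectors, fiber (decode l) ((D : ℚ) / 2)) =
      (shortVectors.biUnion fun l => (finite_fiber (decode l) ((D : ℚ) / 2)).toFinset : Finset _) by
    ext T; simp, Set.ncard_coe_finset, Finset.card_biUnion hdis]
  exact Finset.sum_congr rfl fun l _ => (Set.ncard_eq_toFinset_card _ _).symm

theorem ncard_norm_two : {x ∈ imIntegral | onorm x = 2}.ncard = 756 := by
  rw [← shortSum_norm_two, shortSum_eq]
  have : {x ∈ imIntegral | onorm x = 2} =
      decode '' (shortVectors.filter fun l => digitNorm l = 8) := by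
    ext x
    constructor
    · rintro ⟨hx, hn⟩
      obtain ⟨l, hl, rfl⟩ := exists_decode hx (by rw [hn]; norm_num)
      rw [onorm_decode (mem_boxes_of_mem_shortVectors hl), div_eq_iff (by norm_num)] at hn
      refine ⟨l, ?_, rfl⟩
      rw [Finset.mem_coe, Finset.mem_filter]
      refine ⟨hl, ?_⟩
      have : (digitNorm l : ℚ) = (8 : ℕ) := by push_cast; linarith
      exact_mod_cast this
    · rintro ⟨l, hl, rfl⟩
      rw [Finset.mem_coe, Finset.mem_filter] at hl
      have hb := mem_boxes_of_mem_shortVectors hl.1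
      refine ⟨decode_mem hb, ?_⟩
      rw [onorm_decode hb, hl.2]
      norm_num
  rw [this, Set.InjOn.ncard_image, Set.ncard_coe_finset, Finset.card_filter]
  · refine Finset.sum_congr rfl fun l _ => ?_
    by_cases h : digitNorm l = 8
    · simp [h]
    · have : Nat.beq (digitNorm l) 8 = false := by
        rw [← Bool.not_eq_true, Nat.beq_eq]
        exact h
      simp [h, this]
  · intro l hl l' hl' h
    rw [Finset.mem_coe, Finset.mem_filter] at hl hl'
    exact decode_injOn (mem_boxes_of_mem_shortVectors hl.1)
      (mem_boxes_of_mem_shortVectors hl'.1) h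

/-! ## Closure of the integral Cayley numbers under products -/

/-- The witnesses are the coefficients of the product in the given basis, whose structure constants
are integers. -/
theorem omul_mem_integralCayley {x y : Cayley} (hx : x ∈ integralCayley)
    (hy : y ∈ integralCayley) : omul x y ∈ integralCayley := by
  obtain ⟨c0, c1, c2, c3, c4, c5, c6, c7, rfl⟩ := mem_integralCayley_coords.1 hx
  obtain ⟨d0, d1, d2, d3, d4, d5, d6, d7, rfl⟩ := mem_integralCayley_coords.1 hy
  refine mem_integralCayley_coords.2 ⟨
    c0 * d0 - c1 * d1 + c1 * d5 - c1 * d6 - c2 * d2 + c2 * d6 - c2 * d7 - c3 * d3 + c3 * d4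
      - c3 * d5 + c3 * d7 - c4 * d1 - c4 * d2 - c4 * d4 + c4 * d5 - c4 * d7 - c5 * d5 - c6 *
      d6 - c7 * d7,
    c0 * d1 + c1 * d0 - c1 * d5 - c1 * d6 - c2 * d3 + c2 * d4 + c2 * d7 + c3 * d2 + c3 * d7
      - c4 * d2 + c5 * d6 - c6 * d5 - c7 * d1 - c7 * d2 - c7 * d3,
    c0 * d2 + c1 * d3 - c1 * d4 + c1 * d5 + c2 * d0 - c2 * d6 - c2 * d7 - c3 * d1 + c3 * d5
      + c4 * d1 - c5 * d1 - c5 * d2 - c5 * d3 + c6 * d7 - c7 * d6,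
    c0 * d3 - c1 * d2 + c1 * d6 - c1 * d7 + c2 * d1 - c2 * d5 + c2 * d6 + c3 * d0 - c3 * d5
      - c3 * d6 - c3 * d7 + c4 * d6 + c5 * d2 - c5 * d6 - c6 * d1 - c6 * d2 - c6 * d4 + c6 *
      d5 - c6 * d7 + c7 * d1 + c7 * d6,
    c0 * d4 - c1 * d7 - c2 * d5 - c3 * d6 + c4 * d0 - c4 * d5 - c4 * d7 + c5 * d2 - c5 * d6
      + c5 * d7 + c6 * d3 - c6 * d4 + c6 * d5 - c6 * d7 + c7 * d1 - c7 * d5 + c7 * d6,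
    c0 * d5 - c1 * d6 + c2 * d4 + c3 * d7 - c4 * d2 - c4 * d7 + c5 * d0 - c5 * d5 + c6 * d1
      - c6 * d5 - c7 * d3 + c7 * d4 - c7 * d5,
    c0 * d6 + c1 * d5 - c2 * d7 + c3 * d4 - c4 * d3 - c5 * d1 - c5 * d6 + c6 * d0 - c6 * d6
      + c7 * d2 - c7 * d6,
    c0 * d7 + c1 * d4 + c2 * d6 - c3 * d5 - c4 * d1 + c4 * d5 + c5 * d3 - c5 * d4 - c5 * d7
      - c6 * d2 - c6 * d7 + c7 * d0 - c7 * d7, ?_⟩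
  simp only [omul, Matrix.cons_val]
  push_cast
  ext i
  fin_cases i <;> simp only [Fin.reduceFinMk, Fin.isValue, Fin.zero_eta, Fin.mk_one,
    Matrix.cons_val] <;> ring

theorem oconj_mem_integralCayley {x : Cayley} (hx : x ∈ integralCayley) :
    oconj x ∈ integralCayley := by
  obtain ⟨c0, c1, c2, c3, c4, c5, c6, c7, rfl⟩ := mem_integralCayley_coords.1 hx
  refine mem_integralCayley_coords.2
    ⟨c0 - c5 - c6 - c7, -c1, -c2, -c3, -c4, -c5, -c6, -c7, ?_⟩
  ext i
  fin_cases i <;> simp [oconj] <;> ring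

theorem intCast_smul_mem_integralCayley (n : ℤ) {x : Cayley} (hx : x ∈ integralCayley) :
    (n : ℚ) • x ∈ integralCayley := by
  rw [Int.cast_smul_eq_zsmul]
  exact zsmul_mem hx n

namespace Jordan

theorem IsIntegral.cross {T : Jordan} (hT : T.IsIntegral) : T.cross.IsIntegral := by
  obtain ⟨⟨a, ha⟩, ⟨b, hb⟩, ⟨c, hc⟩, hx, hy, hz⟩ := hT
  obtain ⟨nx, hnx⟩ := exists_int_onorm hx
  obtain ⟨ny, hny⟩ := exists_int_onorm hy
  obtain ⟨nz, hnz⟩ := exists_int_onorm hz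
  simp only [IsIntegral, Jordan.cross, ha, hb, hc, hnx, hny, hnz]
  refine ⟨⟨b * c - nz, by push_cast; rfl⟩, ⟨a * c - ny, by push_cast; rfl⟩,
    ⟨a * b - nx, by push_cast; rfl⟩, ?_, ?_, ?_⟩
  · exact sub_mem (omul_mem_integralCayley hy (oconj_mem_integralCayley hz))
      (intCast_smul_mem_integralCayley c hx)
  · exact sub_mem (omul_mem_integralCayley hx hz) (intCast_smul_mem_integralCayley b hy)
  · exact sub_mem (omul_mem_integralCayley (oconj_mem_integralCayley hx) hy)
      (intCast_smul_mem_integralCayley a hz)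

theorem scale_one (T : Jordan) : T.scale 1 = T := by simp [scale]

theorem content_eq {T T' : Jordan} {n : ℕ} (hT' : T'.IsIntegral) (h : T = T'.scale n)
    (hmax : ∀ (m : ℕ) (S : Jordan), S.IsIntegral → T = S.scale m → m ≤ n) : T.content = n := by
  refine IsGreatest.csSup_eq ⟨⟨T', hT', h⟩, ?_⟩
  rintro m ⟨S, hS, hm⟩
  exact hmax m S hS hm

/-- By `c_mul_det`, `c · det T` is a 2 × 2 minor of `T × T`, so it carries a factor `m²`. -/
theorem sq_dvd_of_cross_eq_scale {T S : Jordan} {m : ℕ} {e : ℤ} (hS : S.IsIntegral)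
    (h : T.cross = S.scale m) (he : T.c * T.det = e) : (m : ℤ) ^ 2 ∣ e := by
  obtain ⟨⟨a, ha⟩, ⟨b, hb⟩, -, hx, -⟩ := hS
  obtain ⟨n, hn⟩ := exists_int_onorm hx
  refine ⟨a * b - n, ?_⟩
  have := T.c_mul_det
  rw [h, he] at this
  simp only [scale, onorm_smul, ha, hb, hn] at this
  have h2 : (e : ℚ) = ((m ^ 2 * (a * b - n) : ℤ) : ℚ) := by
    rw [this]
    push_cast
    ring
  exact_mod_cast h2

end Jordan

/-! ## The invariants of the elements of `posTwo` -/

theorem eq_zero_of_onorm_lt_one {x : Cayley} (hx : x ∈ integralCayley) (h : onorm x < 1) :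
    x = 0 := by
  obtain ⟨n, hn⟩ := exists_int_onorm hx
  have h0 := onorm_nonneg x
  rw [hn] at h h0
  have h1 : n < 1 := by exact_mod_cast h
  have h2 : 0 ≤ n := by exact_mod_cast h0
  rw [← onorm_eq_zero, hn, show n = 0 by omega, Int.cast_zero]

theorem eq_zero_of_two_smul {x : Cayley} (hx : x ∈ integralCayley)
    (h : onorm ((2 : ℚ) • x) < 4) : x = 0 := by
  rw [onorm_smul] at h
  exact eq_zero_of_onorm_lt_one hx (by linarith)

/-- The diagonal forces `m ∣ 2`. If `m = 2`, the halved octonion entries are integral of norm less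
than 1, hence zero. -/
theorem content_of_ne {T : Jordan} (hT : T ∈ posTwo) (h0 : T ≠ twoDiag 0 0 0) : T.content = 1 := by
  refine Jordan.content_eq hT.1 (by rw [Nat.cast_one, Jordan.scale_one]) fun m S hS h => ?_
  obtain ⟨x, hx, y, hy, z, hz, rfl, hx4, hy4, hz4, -⟩ := mem_posTwo.1 hT
  obtain ⟨⟨a, ha⟩, -, -, hx', hy', hz'⟩ := hS
  simp only [twoDiag, Jordan.scale, Jordan.mk.injEq, ha] at h
  obtain ⟨h2, -, -, rfl, rfl, rfl⟩ := h
  have h2' : (2 : ℤ) = m * a := by exact_mod_cast h2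
  have hm : m ≤ 2 := by
    have : (m : ℤ) ∣ 2 := ⟨a, h2'⟩
    have := Int.le_of_dvd (by norm_num) this
    omega
  by_contra hm1
  obtain rfl : m = 2 := by omega
  rw [Nat.cast_ofNat] at hx4 hy4 hz4
  refine h0 ?_
  rw [eq_zero_of_two_smul hx' hx4, eq_zero_of_two_smul hy' hy4, eq_zero_of_two_smul hz' hz4]
  simp

theorem onorm_zero : onorm 0 = 0 := onorm_eq_zero.2 rfl

theorem omul_zero (x : Cayley) : omul x 0 = 0 := by
  ext i
  fin_cases i <;> simp [omul]

theorem zero_omul (x : Cayley) : omul 0 x = 0 := by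
  ext i
  fin_cases i <;> simp [omul]

theorem oconj_zero : oconj 0 = 0 := by
  ext i
  simp [oconj]

theorem zero_mem_imIntegral : 0 ∈ imIntegral := ⟨zero_mem _, rfl⟩

theorem det_twoDiag_zero : (twoDiag 0 0 0).det = 8 := by
  rw [det_twoDiag]
  simp [onorm_zero, omul_zero, zero_omul, otrace]

theorem twoDiag_zero_mem : twoDiag 0 0 0 ∈ posTwo := by
  rw [twoDiag_mem_posTwo, onorm_zero, det_twoDiag_zero]
  exact ⟨⟨zero_mem_imIntegral, zero_mem_imIntegral, zero_mem_imIntegral⟩, by norm_num⟩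

/-- Equality in `2 det ≤ (4 - N) (4 - N') ≤ 16` forces all norms to vanish. -/
theorem eq_twoDiag_zero {T : Jordan} (hT : T ∈ posTwo) (hd : T.det = 8) : T = twoDiag 0 0 0 := by
  obtain ⟨x, hx, y, hy, z, hz, rfl, hx4, hy4, hz4, -⟩ := mem_posTwo.1 hT
  have h1 := det_twoDiag_x x y z
  have h2 := det_twoDiag_y x y z
  have := onorm_nonneg x
  have := onorm_nonneg y
  have := onorm_nonneg z
  have := onorm_nonneg (omul x z - (2 : ℚ) • y)
  have := onorm_nonneg (omul y (oconj z) - (2 : ℚ) • x)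
  rw [onorm_eq_zero.1 (show onorm x = 0 by nlinarith),
    onorm_eq_zero.1 (show onorm y = 0 by nlinarith),
    onorm_eq_zero.1 (show onorm z = 0 by nlinarith)]

theorem isIntegral_of_int {a b c : ℤ} {x y z : Cayley} (hx : x ∈ integralCayley)
    (hy : y ∈ integralCayley) (hz : z ∈ integralCayley) :
    (⟨a, b, c, x, y, z⟩ : Jordan).IsIntegral :=
  ⟨⟨a, rfl⟩, ⟨b, rfl⟩, ⟨c, rfl⟩, hx, hy, hz⟩

theorem content_cross_bound {T S : Jordan} (hT : T ∈ posTwo) {D m : ℕ} (hd : T.det = D / 2)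
    (hS : S.IsIntegral) (h : T.cross = S.scale m) : m ^ 2 ∣ D := by
  have hc : T.c * T.det = (D : ℤ) := by
    obtain ⟨x, -, y, -, z, -, rfl, -⟩ := mem_posTwo.1 hT
    rw [hd]
    simp only [twoDiag]
    push_cast
    ring
  exact_mod_cast Jordan.sq_dvd_of_cross_eq_scale hS h hc

theorem invariant_twoDiag_zero : (twoDiag 0 0 0).invariant = (2, 4, 8) := by
  have h1 : (twoDiag 0 0 0).content = 2 := by
    refine Jordan.content_eq (T' := ⟨(1 : ℤ), (1 : ℤ), (1 : ℤ), 0, 0, 0⟩)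
      (isIntegral_of_int (zero_mem _) (zero_mem _) (zero_mem _))
      (by simp [twoDiag, Jordan.scale]) fun m S hS h => ?_
    obtain ⟨⟨a, ha⟩, -⟩ := hS
    have := congrArg Jordan.a h
    simp only [twoDiag, Jordan.scale, ha] at this
    have h2' : (2 : ℤ) = m * a := by exact_mod_cast this
    have := Int.le_of_dvd (by norm_num) (show (m : ℤ) ∣ 2 from ⟨a, h2'⟩)
    omega
  have h2 : (twoDiag 0 0 0).cross.content = 4 := by
    refine Jordan.content_eq (T' := ⟨(1 : ℤ), (1 : ℤ), (1 : ℤ), 0, 0, 0⟩)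
      (isIntegral_of_int (zero_mem _) (zero_mem _) (zero_mem _)) ?_ fun m S hS h => ?_
    · simp [twoDiag, Jordan.cross, Jordan.scale, omul_zero, zero_omul, onorm_zero]
      norm_num
    · have := content_cross_bound (D := 16) twoDiag_zero_mem
        (by rw [det_twoDiag_zero]; norm_num) hS h
      have := Nat.le_of_dvd (by norm_num) this
      nlinarith
  rw [Jordan.invariant, h1, h2, det_twoDiag_zero]

/-- The elements of `posTwo` with exactly one non-zero octonion entry, of norm `2`. -/
def singleEntry : Set Jordan :=
  (twoDiag · 0 0) '' {w ∈ imIntegral | onorm w = 2} ∪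
    ((twoDiag 0 · 0) '' {w ∈ imIntegral | onorm w = 2} ∪
      (twoDiag 0 0 ·) '' {w ∈ imIntegral | onorm w = 2})

theorem ncard_singleEntry : singleEntry.ncard = 2268 := by
  have hfin : {w ∈ imIntegral | onorm w = 2}.Finite :=
    Set.finite_of_ncard_ne_zero (by rw [ncard_norm_two]; norm_num)
  have hne : ∀ w ∈ {w ∈ imIntegral | onorm w = 2}, w ≠ 0 := by
    rintro w ⟨-, hw⟩ rfl
    rw [onorm_zero] at hw
    norm_num at hw
  rw [singleEntry, Set.ncard_union_eq _ (hfin.image _) ((hfin.image _).union (hfin.image _)),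
    Set.ncard_union_eq _ (hfin.image _) (hfin.image _), Set.ncard_image_of_injective,
    Set.ncard_image_of_injective, Set.ncard_image_of_injective, ncard_norm_two]
  · intro x y h
    simpa [twoDiag] using h
  · intro x y h
    simpa [twoDiag] using h
  · intro x y h
    simpa [twoDiag] using h
  · rw [Set.disjoint_left]
    rintro _ ⟨w, hw, rfl⟩ ⟨w', hw', h⟩
    simp only [twoDiag, Jordan.mk.injEq] at h
    exact hne w hw h.2.2.2.2.1.symm
  · rw [Set.disjoint_left]
    rintro _ ⟨w, hw, rfl⟩ (⟨w', hw', h⟩ | ⟨w', hw', h⟩) <;>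
    · simp only [twoDiag, Jordan.mk.injEq] at h
      exact hne w hw h.2.2.2.1.symm

theorem singleEntry_spec {T : Jordan} (hT : T ∈ singleEntry) :
    T ∈ posTwo ∧ T.det = 4 ∧ T ≠ twoDiag 0 0 0 ∧ ∃ S : Jordan, S.IsIntegral ∧
      T.cross = S.scale 2 := by
  have hne : ∀ w, onorm w = 2 → w ≠ 0 := by
    rintro w hw rfl
    rw [onorm_zero] at hw
    norm_num at hw
  rcases hT with ⟨w, ⟨hw, hn⟩, rfl⟩ | ⟨w, ⟨hw, hn⟩, rfl⟩ | ⟨w, ⟨hw, hn⟩, rfl⟩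
  all_goals
    dsimp only
    rw [twoDiag_mem_posTwo]
    have hd : ∀ d, d = (4 : ℚ) → (0 < d ∧ d = 4) := by rintro _ rfl; norm_num
    simp only [hn, onorm_zero, zero_mem_imIntegral, hw, true_and]
  · have hd := hd (twoDiag w 0 0).det (by
      rw [det_twoDiag]; simp [onorm_zero, hn, omul_zero, zero_omul, otrace]; norm_num)
    refine ⟨⟨by norm_num, by norm_num, by norm_num, hd.1⟩, hd.2, ?_, ⟨(2 : ℤ), (2 : ℤ), (1 : ℤ),
      -w, 0, 0⟩,
      isIntegral_of_int (neg_mem hw.1) (zero_mem _) (zero_mem _), ?_⟩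
    · simpa [twoDiag] using hne w hn
    · simp [twoDiag, Jordan.cross, Jordan.scale, omul_zero, zero_omul, onorm_zero, hn]
      norm_num
  · have hd := hd (twoDiag 0 w 0).det (by
      rw [det_twoDiag]; simp [onorm_zero, hn, omul_zero, zero_omul, otrace]; norm_num)
    refine ⟨⟨by norm_num, by norm_num, by norm_num, hd.1⟩, hd.2, ?_, ⟨(2 : ℤ), (1 : ℤ), (2 : ℤ), 0,
      -w, 0⟩,
      isIntegral_of_int (zero_mem _) (neg_mem hw.1) (zero_mem _), ?_⟩
    · simpa [twoDiag] using hne w hn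
    · simp [twoDiag, Jordan.cross, Jordan.scale, omul_zero, zero_omul, onorm_zero, hn, oconj_zero]
      norm_num
  · have hd := hd (twoDiag 0 0 w).det (by
      rw [det_twoDiag]; simp [onorm_zero, hn, zero_omul, otrace]; norm_num)
    refine ⟨⟨by norm_num, by norm_num, by norm_num, hd.1⟩, hd.2, ?_, ⟨(1 : ℤ), (2 : ℤ), (2 : ℤ), 0,
      0, -w⟩,
      isIntegral_of_int (zero_mem _) (zero_mem _) (neg_mem hw.1), ?_⟩
    · simpa [twoDiag] using hne w hn
    · simp [twoDiag, Jordan.cross, Jordan.scale, omul_zero, zero_omul, onorm_zero, hn]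
      norm_num

/-- Evenness of the diagonal of `T × T` leaves only the norms 0 and 2, so it remains to exclude two
non-zero entries. -/
theorem mem_singleEntry_of_cross {T S : Jordan} (hT : T ∈ posTwo) (h0 : T ≠ twoDiag 0 0 0)
    (hS : S.IsIntegral) (h : T.cross = S.scale 2) : T ∈ singleEntry := by
  obtain ⟨x, hx, y, hy, z, hz, rfl, hx4, hy4, hz4, hpos⟩ := mem_posTwo.1 hT
  obtain ⟨⟨a, ha⟩, ⟨b, hb⟩, ⟨c, hc⟩, hx', hy', hz'⟩ := hS
  have eqs := Jordan.ext_iff.1 h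
  simp only [Jordan.cross, twoDiag, Jordan.scale, ha, hb, hc] at eqs
  obtain ⟨h1, h2, h3, h4, h5, h6⟩ := eqs
  have even : ∀ w ∈ imIntegral, onorm w < 4 → ∀ n : ℤ, 2 * 2 - onorm w = 2 * n →
      w = 0 ∨ onorm w = 2 := by
    intro w hw hw4 n hn
    obtain ⟨m, hm⟩ := exists_int_onorm hw.1
    have h0 := onorm_nonneg w
    rw [hm] at hn hw4 h0
    have e1 : 2 * 2 - m = 2 * n := by exact_mod_cast hn
    have e2 : m < 4 := by exact_mod_cast hw4
    have e3 : 0 ≤ m := by exact_mod_cast h0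
    rcases (show m = 0 ∨ m = 2 by omega) with rfl | rfl
    · exact Or.inl (onorm_eq_zero.1 (by simpa using hm))
    · exact Or.inr (by simpa using hm)
  -- Let `v` be the product of two entries of norm 2 and `w` the third entry. Positivity gives `N(v
  -- - 2w) < 4`; divisibility by 2 then forces `v = 2w`, so `N(w) = 1`, which is excluded.
  have key : ∀ u ∈ integralCayley, ∀ w v : Cayley, onorm v = 4 → onorm w ≠ 1 →
      v - (2 : ℚ) • w = (2 : ℚ) • u → onorm (v - (2 : ℚ) • w) < 4 → False := by
    intro u hu w v hv hw he hlt
    rw [he] at hlt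
    rw [eq_zero_of_two_smul hu hlt, smul_zero, sub_eq_zero] at he
    rw [he, onorm_smul] at hv
    exact hw (by linarith)
  have ne1 : ∀ w : Cayley, w = 0 ∨ onorm w = 2 → onorm w ≠ 1 := by
    rintro w (rfl | hw)
    · rw [onorm_zero]; norm_num
    · rw [hw]; norm_num
  have ex := even x hx hx4 c h3
  have ey := even y hy hy4 b h2
  have ez := even z hz hz4 a h1
  have dx := det_twoDiag_x x y z
  have dy := det_twoDiag_y x y z
  have dz := det_twoDiag_z x y z
  rcases ex with rfl | nx
  · rcases ey with rfl | ny
    · rcases ez with rfl | nz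
      · exact absurd rfl h0
      · exact Or.inr (Or.inr ⟨z, ⟨hz, nz⟩, rfl⟩)
    · rcases ez with rfl | nz
      · exact Or.inr (Or.inl ⟨y, ⟨hy, ny⟩, rfl⟩)
      · refine (key _ hx' 0 _ ?_ (ne1 _ (Or.inl rfl)) h4 ?_).elim
        · rw [onorm_omul, onorm_oconj, ny, nz]; norm_num
        · rw [ny, nz] at dx; linarith
  · rcases ey with rfl | ny
    · rcases ez with rfl | nz
      · exact Or.inl ⟨x, ⟨hx, nx⟩, rfl⟩
      · refine (key _ hy' 0 _ ?_ (ne1 _ (Or.inl rfl)) h5 ?_).elim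
        · rw [onorm_omul, nx, nz]; norm_num
        · rw [nx, nz] at dy; linarith
    · refine (key _ hz' z _ ?_ (ne1 _ ez) h6 ?_).elim
      · rw [onorm_omul, onorm_oconj, nx, ny]; norm_num
      · rw [nx, ny] at dz; linarith

theorem invariant_of_mem_singleEntry {T : Jordan} (hT : T ∈ singleEntry) :
    T.invariant = (1, 2, 4) := by
  obtain ⟨hp, hd, h0, S, hS, hc⟩ := singleEntry_spec hT
  rw [Jordan.invariant, content_of_ne hp h0, hd]
  congr 2
  refine Jordan.content_eq hS hc fun m S' hS' h => ?_
  have h8 := content_cross_bound (D := 8) hp (by rw [hd]; norm_num) hS' h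
  by_contra hm
  have := Nat.le_of_dvd (by norm_num) h8
  nlinarith

theorem invariant_of_notMem {T : Jordan} (hT : T ∈ posTwo) (hs : T ∉ singleEntry)
    (hd : T.det ≠ 8) : T.invariant = (1, 1, T.det) := by
  have h0 : T ≠ twoDiag 0 0 0 := by
    rintro rfl
    exact hd det_twoDiag_zero
  obtain ⟨D, hD, he⟩ := exists_det_eq hT
  rw [Jordan.invariant, content_of_ne hT h0]
  congr 2
  refine Jordan.content_eq (T' := T.cross) hT.1.cross (by rw [Nat.cast_one, Jordan.scale_one])
    fun m S hS h => ?_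
  have hdvd := content_cross_bound hT he hS h
  have hD16 : D ≠ 16 := by
    rintro rfl
    rw [he] at hd
    norm_num at hd
  have hDpos : 0 < D ∧ D ≤ 12 := by
    simp only [List.mem_cons, List.not_mem_nil, or_false] at hD
    omega
  have hm3 : m ≤ 3 := by
    by_contra hm
    have := Nat.le_of_dvd hDpos.1 hdvd
    nlinarith
  by_contra hm
  obtain rfl | rfl : m = 2 ∨ m = 3 := by omega
  · exact hs (mem_singleEntry_of_cross hT h0 hS (by rw [h, Nat.cast_ofNat]))
  · simp only [List.mem_cons, List.not_mem_nil, or_false] at hD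
    omega

/-! ## The Hecke operator `T₂` -/

open Function.Periodic in
theorem hasSum_fourierCoeff {w : ℤ} (f : CuspForm 𝒮ℒ w) {z : ℂ} (hz : 0 < z.im) :
    HasSum (fun m => fourierCoeff f m * qParam 1 z ^ m) (f (UpperHalfPlane.ofComplex z)) := by
  rw [UpperHalfPlane.ofComplex_apply_of_im_pos hz]
  exact ModularForm.hasSum_qExpansion f one_pos one_mem_strictPeriods_SL ⟨z, hz⟩

theorem qParam_one_sq (z : ℂ) :
    Function.Periodic.qParam 1 z ^ 2 = Function.Periodic.qParam 1 (2 * z) := by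
  rw [Function.Periodic.qParam, Function.Periodic.qParam, ← Complex.exp_nat_mul]
  congr 1
  push_cast
  ring

theorem qParam_one_add_half (z : ℂ) :
    Function.Periodic.qParam 1 (z + 1 / 2) = -Function.Periodic.qParam 1 z := by
  rw [Function.Periodic.qParam, Function.Periodic.qParam, ← Complex.exp_add_pi_mul_I]
  congr 1
  push_cast
  ring

theorem heckeOp_two (w : ℤ) (f : UpperHalfPlane → ℂ) (z : UpperHalfPlane) :
    heckeOp w 2 f z = 2 ^ (w - 1) * (f (UpperHalfPlane.ofComplex (2 * z)) + 2 ^ (-w) *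
      (f (UpperHalfPlane.ofComplex (z / 2)) + f (UpperHalfPlane.ofComplex (z / 2 + 1 / 2)))) := by
  have h2 : Nat.divisors 2 = {1, 2} := by decide
  rw [heckeOp, h2, Finset.sum_pair (by norm_num)]
  simp [Finset.sum_range_succ, mul_add, add_div]

/-- The Fourier coefficients of `T₂ f`. -/
theorem hasSum_heckeOp_two {w : ℤ} (f : CuspForm 𝒮ℒ w) (z : UpperHalfPlane) :
    HasSum (fun m : ℕ => (fourierCoeff f (2 * m) +
      2 ^ (w - 1) * if Even m then fourierCoeff f (m / 2) else 0) *
        Function.Periodic.qParam 1 z ^ m) (heckeOp w 2 f z) := by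
  have hz := z.im_pos
  have h1 := hasSum_fourierCoeff f (z := 2 * z) (by simpa using hz)
  have h2 := hasSum_fourierCoeff f (z := z / 2) (by simpa using hz)
  have h3 := hasSum_fourierCoeff f (z := z / 2 + 1 / 2) (by simpa using hz)
  have inj : Function.Injective (fun m : ℕ => 2 * m) := fun m n h => by simpa using h
  -- The half-period shift changes the sign of the odd terms, so only even indices survive.
  have h4 : HasSum (fun m : ℕ => 2 * fourierCoeff f (2 * m) * Function.Periodic.qParam 1 z ^ m)
      (f (UpperHalfPlane.ofComplex (z / 2)) + f (UpperHalfPlane.ofComplex (z / 2 + 1 / 2))) := by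
    refine ((inj.hasSum_iff ?_).2 (h2.add h3)).congr_fun ?_
    · intro m hm
      have hodd : Odd m := by
        rw [← Nat.not_even_iff_odd]
        rintro ⟨n, rfl⟩
        exact hm ⟨n, by simp only; omega⟩
      rw [qParam_one_add_half, hodd.neg_pow]
      ring
    · intro m
      have hs : Function.Periodic.qParam 1 (z / 2 : ℂ) ^ 2 = Function.Periodic.qParam 1 z := by
        rw [qParam_one_sq, mul_div_cancel₀ _ two_ne_zero]
      simp only [Function.comp_apply]
      rw [qParam_one_add_half, pow_mul, pow_mul, neg_sq, hs]
      ring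
  have h5 : HasSum (fun m : ℕ => (if Even m then fourierCoeff f (m / 2) else 0) *
      Function.Periodic.qParam 1 z ^ m) (f (UpperHalfPlane.ofComplex (2 * z))) := by
    refine (inj.hasSum_iff ?_).1 (h1.congr_fun ?_)
    · intro m hm
      rw [if_neg, zero_mul]
      rintro ⟨n, rfl⟩
      exact hm ⟨n, by simp only; omega⟩
    · intro m
      simp only [Function.comp_apply]
      rw [if_pos (even_two_mul m), Nat.mul_div_cancel_left _ two_pos, pow_mul, qParam_one_sq]
  have hw : (2 : ℂ) ^ (w - 1) * (2 ^ (-w) * 2) = 1 := by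
    rw [← zpow_add_one₀ two_ne_zero, ← zpow_add₀ two_ne_zero]
    norm_num
  rw [heckeOp_two]
  refine ((h5.add (h4.mul_left (2 ^ (-w)))).mul_left (2 ^ (w - 1))).congr_fun fun m => ?_
  linear_combination (-fourierCoeff f (2 * m) * Function.Periodic.qParam 1 z ^ m) * hw

/-- Uniqueness of the `q`-expansion turns the eigenvalue equation into one for coefficients; the
coefficient at 1 identifies the eigenvalue as `a(2)`. -/
theorem fourierCoeff_hecke_two {w : ℤ} {f : CuspForm 𝒮ℒ w} (hf : IsNormalizedEigenform f)
    (m : ℕ) :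
    fourierCoeff f (2 * m) + 2 ^ (w - 1) * (if Even m then fourierCoeff f (m / 2) else 0) =
      fourierCoeff f 2 * fourierCoeff f m := by
  obtain ⟨h1, h⟩ := hf
  obtain ⟨c, hc⟩ := h 2 one_le_two
  have key : ∀ m, fourierCoeff f (2 * m) +
      2 ^ (w - 1) * (if Even m then fourierCoeff f (m / 2) else 0) = c * fourierCoeff f m := by
    intro m
    have hu := ModularFormClass.qExpansion_coeff_unique (f := c • f) one_pos
      one_mem_strictPeriods_SL (c := fun m => fourierCoeff f (2 * m) +
      2 ^ (w - 1) * (if Even m then fourierCoeff f (m / 2) else 0)) (fun z => by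
        have := hasSum_heckeOp_two f z
        rw [hc] at this
        simpa using this) m
    rw [hu, FunLike.coe_smul,
      ModularForm.qExpansion_smul one_pos one_mem_strictPeriods_SL]
    simp [fourierCoeff]
  have hc1 := key 1
  rw [if_neg (by decide), h1] at hc1
  rw [key, ← mul_one c, ← hc1]
  simp

theorem fourierCoeff_four {w : ℤ} {f : CuspForm 𝒮ℒ w} (hf : IsNormalizedEigenform f) :
    fourierCoeff f 4 = fourierCoeff f 2 ^ 2 - 2 ^ (w - 1) := by
  have h := fourierCoeff_hecke_two hf 2
  rw [if_pos even_two, Nat.div_self two_pos, hf.1] at h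
  linear_combination h

theorem fourierCoeff_six {w : ℤ} {f : CuspForm 𝒮ℒ w} (hf : IsNormalizedEigenform f) :
    fourierCoeff f 6 = fourierCoeff f 2 * fourierCoeff f 3 := by
  have h := fourierCoeff_hecke_two hf 3
  rw [if_neg (by decide)] at h
  linear_combination h

/-! ## The Fourier coefficients of the lift -/

/-- `p^{(2k-9)/2}`. -/
def halfPow (k n : ℕ) : ℂ := (((n : ℝ) ^ ((2 * (k : ℝ) - 9) / 2) : ℝ) : ℂ)

theorem halfPow_one (k : ℕ) : halfPow k 1 = 1 := by simp [halfPow]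

theorem halfPow_mul (k m n : ℕ) : halfPow k (m * n) = halfPow k m * halfPow k n := by
  simp only [halfPow]
  rw [Nat.cast_mul, Real.mul_rpow (Nat.cast_nonneg _) (Nat.cast_nonneg _), Complex.ofReal_mul]

theorem halfPow_sq {k : ℕ} (hk : 9 ≤ 2 * k) (n : ℕ) : halfPow k n ^ 2 = (n : ℂ) ^ (2 * k - 9) := by
  rw [halfPow, ← Complex.ofReal_pow, ← Real.rpow_natCast, ← Real.rpow_mul (Nat.cast_nonneg _)]
  have : (2 * (k : ℝ) - 9) / 2 * (2 : ℕ) = ((2 * k - 9 : ℕ) : ℝ) := by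
    rw [Nat.cast_sub hk]
    push_cast
    ring
  rw [this, Real.rpow_natCast]
  push_cast
  rfl

/-- The value of `f̃_T^p` in terms of the `p`-adic valuations of `d(T)`. -/
def localValue (p e₁ e₂ e₃ : ℕ) (X : ℂ) : ℂ :=
  X ^ e₃ * Polynomial.aeval (X⁻¹ ^ 2) (karelPoly p e₁ e₂ e₃)

theorem localValue_zero_zero_one (p : ℕ) {X : ℂ} (hX : X ≠ 0) :
    localValue p 0 0 1 X = X + X⁻¹ := by
  have : karelPoly p 0 0 1 = 1 + Polynomial.X := by
    simp [karelPoly, Finset.sum_filter, Finset.sum_range_succ]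
  rw [localValue, this]
  simp only [map_add, map_one, Polynomial.aeval_X]
  field_simp

theorem localValue_zero_zero_two (p : ℕ) {X : ℂ} (hX : X ≠ 0) :
    localValue p 0 0 2 X = (X + X⁻¹) ^ 2 - 1 := by
  have : karelPoly p 0 0 2 = 1 + Polynomial.X + Polynomial.X ^ 2 := by
    simp [karelPoly, Finset.sum_filter, Finset.sum_range_succ]
  rw [localValue, this]
  simp only [map_add, map_one, map_pow, Polynomial.aeval_X]
  field_simp
  ring

/-- The extra term `(l, j) = (0, 1)` adds `2⁴ X`, turning the constant -1 into 15. -/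
theorem localValue_zero_one_two {X : ℂ} (hX : X ≠ 0) :
    localValue 2 0 1 2 X = (X + X⁻¹) ^ 2 + 15 := by
  have : karelPoly 2 0 1 2 = 1 + Polynomial.X + Polynomial.X ^ 2 + 16 * Polynomial.X := by
    simp [karelPoly, Finset.sum_filter, Finset.sum_range_succ]
    norm_num
  rw [localValue, this]
  simp only [map_add, map_one, map_pow, map_mul, Polynomial.aeval_X, map_ofNat]
  field_simp
  ring

/-- The terms `(0, 1)` and `(1, 0)` contribute `2⁴ + 2⁸ = 272`; rewriting `X³ + X⁻³` and adding `X +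
X⁻¹` leaves 272 - 3 + 1 = 270. -/
theorem localValue_one_two_three {X : ℂ} (hX : X ≠ 0) :
    localValue 2 1 2 3 X = (X + X⁻¹) ^ 3 + 270 * (X + X⁻¹) := by
  have : karelPoly 2 1 2 3 = 1 + Polynomial.X + Polynomial.X ^ 2 + Polynomial.X ^ 3
      + 272 * (Polynomial.X + Polynomial.X ^ 2) := by
    simp [karelPoly, Finset.sum_filter, Finset.sum_range_succ]
    ring
  rw [localValue, this]
  simp only [map_add, map_one, map_pow, map_mul, Polynomial.aeval_X, map_ofNat]
  field_simp
  ring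

theorem ikedaCoeff_eq {T : Jordan} (hi : T.IsIntegral) (hp : T.IsPos) {d₁ d₂ d₃ : ℕ}
    (h : T.invariant = (d₁, d₂, (d₃ : ℚ))) (k : ℕ) (α : ℕ → ℂ) :
    ikedaCoeff k α T = halfPow k d₃ * ∏ p ∈ d₃.primeFactors,
      localValue p (padicValNat p d₁) (padicValNat p d₂) (padicValNat p d₃) (α p) := by
  simp only [Jordan.invariant, Prod.mk.injEq] at h
  obtain ⟨h1, h2, h3⟩ := h
  have hn : T.detNat = d₃ := by simp [Jordan.detNat, h3]
  rw [ikedaCoeff, if_pos ⟨hi, hp⟩, hn, h3]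
  simp only [localFactor, localPoly, localValue, halfPow, h1, h2, hn]
  simp

/-- The Fourier coefficient of the lift at a `T` with `d(T) = d`, for the `d` that occur here. -/
def classCoeff (k : ℕ) (a : ℕ → ℂ) (d : ℕ × ℕ × ℚ) : ℂ :=
  if d = (1, 1, 1) then 1 else
  if d = (1, 1, 2) then a 2 else
  if d = (1, 1, 3) then a 3 else
  if d = (1, 1, 4) then a 4 else
  if d = (1, 1, 6) then a 6 else
  if d = (1, 2, 4) then a 4 + 2 ^ (2 * k - 5) else
  a 2 ^ 3 + 270 * 2 ^ (2 * k - 9) * a 2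

/-- The invariants `d(T)` that occur. -/
def invariants : Finset (ℕ × ℕ × ℚ) :=
  {(1, 1, 1), (1, 1, 2), (1, 1, 3), (1, 1, 4), (1, 1, 6), (1, 2, 4), (2, 4, 8)}

theorem ikedaCoeff_eq_classCoeff {k : ℕ} (hk : 20 ≤ 2 * k) {f : CuspForm 𝒮ℒ (2 * (k : ℤ) - 8)}
    (hf : IsNormalizedEigenform f) {α : ℕ → ℂ} (hα : IsSatake k f α) {T : Jordan}
    (hi : T.IsIntegral) (hp : T.IsPos) (h : T.invariant ∈ invariants) :
    ikedaCoeff k α T = classCoeff k (fourierCoeff f) T.invariant := by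
  obtain ⟨n2, h2⟩ := hα 2 Nat.prime_two
  obtain ⟨n3, h3⟩ := hα 3 Nat.prime_three
  change _ = halfPow k 2 * _ at h2
  change _ = halfPow k 3 * _ at h3
  have hr : halfPow k 2 ^ 2 = 2 ^ (2 * k - 9) := halfPow_sq (by omega) 2
  have hw : (2 : ℂ) ^ (2 * (k : ℤ) - 8 - 1) = 2 ^ (2 * k - 9) := by
    rw [← zpow_natCast]
    congr 1
    omega
  have h4 := fourierCoeff_four hf
  rw [hw, ← hr] at h4
  have h6 := fourierCoeff_six hf
  have hp4 : halfPow k 4 = halfPow k 2 ^ 2 := by rw [sq, ← halfPow_mul]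
  have hp8 : halfPow k 8 = halfPow k 2 ^ 3 := by rw [pow_succ, ← hp4, ← halfPow_mul]
  have hp6 : halfPow k 6 = halfPow k 2 * halfPow k 3 := by rw [← halfPow_mul]
  have f4 : Nat.primeFactors 4 = {2} :=
    Nat.primeFactors_prime_pow (k := 2) two_ne_zero Nat.prime_two
  have f8 : Nat.primeFactors 8 = {2} :=
    Nat.primeFactors_prime_pow (k := 3) three_ne_zero Nat.prime_two
  have f6 : Nat.primeFactors 6 = {2, 3} := by
    rw [show 6 = 2 * 3 by rfl, Nat.primeFactors_mul two_ne_zero three_ne_zero,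
      Nat.prime_two.primeFactors, Nat.prime_three.primeFactors]
    rfl
  have v42 : padicValNat 2 4 = 2 := padicValNat.prime_pow (p := 2) 2
  have v82 : padicValNat 2 8 = 3 := padicValNat.prime_pow (p := 2) 3
  have v62 : padicValNat 2 6 = 1 := by
    rw [show 6 = 2 * 3 by rfl, padicValNat.mul two_ne_zero three_ne_zero, padicValNat_self,
      padicValNat.eq_zero_of_not_dvd (by decide)]
  have v63 : padicValNat 3 6 = 1 := by
    rw [show 6 = 2 * 3 by rfl, padicValNat.mul two_ne_zero three_ne_zero, padicValNat_self,
      padicValNat.eq_zero_of_not_dvd (by decide)]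
  -- The local constants 15 and -1 for determinant 4 differ by 16, which is the extra `2^(2k-5)` of
  -- the class `(1, 2, 4)`.
  have h5 : (2 : ℂ) ^ (2 * k - 5) = 16 * halfPow k 2 ^ 2 := by
    rw [hr, show 2 * k - 5 = 2 * k - 9 + 4 by omega, pow_add]
    norm_num [mul_comm]
  simp only [invariants, Finset.mem_insert, Finset.mem_singleton] at h
  rcases h with h | h | h | h | h | h | h
  · rw [ikedaCoeff_eq (d₃ := 1) hi hp (by exact_mod_cast h), h, halfPow_one]
    simp [classCoeff]
  · rw [ikedaCoeff_eq (d₃ := 2) hi hp (by exact_mod_cast h), h, Nat.prime_two.primeFactors,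
      Finset.prod_singleton, padicValNat_one_right, padicValNat_self,
      localValue_zero_zero_one _ n2, ← h2]
    simp [classCoeff]
  · rw [ikedaCoeff_eq (d₃ := 3) hi hp (by exact_mod_cast h), h, Nat.prime_three.primeFactors,
      Finset.prod_singleton, padicValNat_one_right, padicValNat_self,
      localValue_zero_zero_one _ n3, ← h3]
    simp [classCoeff]
  · rw [ikedaCoeff_eq (d₃ := 4) hi hp (by exact_mod_cast h), h, f4,
      Finset.prod_singleton, padicValNat_one_right, v42, localValue_zero_zero_two _ n2, hp4]
    simp only [classCoeff, Prod.mk.injEq]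
    norm_num
    rw [h4, h2]
    ring
  · rw [ikedaCoeff_eq (d₃ := 6) hi hp (by exact_mod_cast h), h, f6,
      Finset.prod_pair (by decide), padicValNat_one_right, padicValNat_one_right, v62, v63,
      localValue_zero_zero_one _ n2, localValue_zero_zero_one _ n3, hp6]
    simp only [classCoeff, Prod.mk.injEq]
    norm_num
    rw [h6, h2, h3]
    ring
  · rw [ikedaCoeff_eq (d₃ := 4) hi hp (by exact_mod_cast h), h, f4,
      Finset.prod_singleton, padicValNat_one_right, padicValNat_self, v42,
      localValue_zero_one_two n2, hp4]
    simp only [classCoeff, Prod.mk.injEq]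
    norm_num
    rw [h5, h4, h2]
    ring
  · rw [ikedaCoeff_eq (d₃ := 8) hi hp (by exact_mod_cast h), h, f8,
      Finset.prod_singleton, padicValNat_self, v42, v82, localValue_one_two_three n2, hp8]
    simp only [classCoeff, Prod.mk.injEq]
    norm_num
    rw [← hr, h2]
    ring

/-! ## Classification by `d(T)` and summation -/

theorem det_eq_of_mem_posTwo {T : Jordan} (hT : T ∈ posTwo) :
    T.det = 1 ∨ T.det = 2 ∨ T.det = 3 ∨ T.det = 4 ∨ T.det = 6 ∨ T.det = 8 := by
  obtain ⟨D, hD, h⟩ := exists_det_eq hT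
  simp only [List.mem_cons, List.not_mem_nil, or_false] at hD
  rw [h]
  rcases hD with rfl | rfl | rfl | rfl | rfl | rfl <;> norm_num

theorem invariant_mem_invariants {T : Jordan} (hT : T ∈ posTwo) : T.invariant ∈ invariants := by
  simp only [invariants, Finset.mem_insert, Finset.mem_singleton]
  by_cases h8 : T.det = 8
  · rw [eq_twoDiag_zero hT h8, invariant_twoDiag_zero]
    simp
  by_cases hs : T ∈ singleEntry
  · rw [invariant_of_mem_singleEntry hs]
    simp
  rw [invariant_of_notMem hT hs h8]
  rcases det_eq_of_mem_posTwo hT with h | h | h | h | h | h <;> simp_all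

theorem det_of_invariant {T : Jordan} {d₁ d₂ : ℕ} {d₃ : ℚ} (h : T.invariant = (d₁, d₂, d₃)) :
    T.det = d₃ := by
  simp only [Jordan.invariant, Prod.mk.injEq] at h
  exact h.2.2

theorem setOf_invariant_eq {d : ℚ} (h4 : d ≠ 4) (h8 : d ≠ 8) :
    {T ∈ posTwo | T.invariant = (1, 1, d)} = {T ∈ posTwo | T.det = d} := by
  ext T
  refine and_congr_right fun hT => ⟨det_of_invariant, fun h => ?_⟩
  rw [invariant_of_notMem hT (fun hs => h4 ?_) (h ▸ h8), h]
  rw [← h, (singleEntry_spec hs).2.1]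

theorem setOf_invariant_eq_singleEntry :
    {T ∈ posTwo | T.invariant = (1, 2, 4)} = singleEntry := by
  ext T
  refine ⟨fun ⟨hT, h⟩ => ?_, fun h => ⟨(singleEntry_spec h).1, invariant_of_mem_singleEntry h⟩⟩
  by_contra hs
  rw [invariant_of_notMem hT hs (by rw [det_of_invariant h]; norm_num)] at h
  simp at h

theorem setOf_invariant_eq_diff :
    {T ∈ posTwo | T.invariant = (1, 1, 4)} = {T ∈ posTwo | T.det = 4} \ singleEntry := by
  ext T
  constructor
  · rintro ⟨hT, h⟩
    refine ⟨⟨hT, det_of_invariant h⟩, fun hs => ?_⟩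
    rw [invariant_of_mem_singleEntry hs] at h
    simp at h
  · rintro ⟨⟨hT, h⟩, hs⟩
    refine ⟨hT, ?_⟩
    rw [invariant_of_notMem hT hs (by rw [h]; norm_num), h]

theorem setOf_invariant_eq_eight :
    {T ∈ posTwo | T.invariant = (2, 4, 8)} = {T ∈ posTwo | T.det = 8} := by
  ext T
  refine and_congr_right fun hT => ⟨det_of_invariant, fun h => ?_⟩
  rw [eq_twoDiag_zero hT h, invariant_twoDiag_zero]

theorem ncard_invariant :
    {T ∈ posTwo | T.invariant = (1, 1, 1)}.ncard = 18192384 ∧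
    {T ∈ posTwo | T.invariant = (1, 1, 2)}.ncard = 3752952 ∧
    {T ∈ posTwo | T.invariant = (1, 1, 3)}.ncard = 459648 ∧
    {T ∈ posTwo | T.invariant = (1, 1, 4)}.ncard = 55188 ∧
    {T ∈ posTwo | T.invariant = (1, 1, 6)}.ncard = 378 ∧
    {T ∈ posTwo | T.invariant = (1, 2, 4)}.ncard = 2268 ∧
    {T ∈ posTwo | T.invariant = (2, 4, 8)}.ncard = 1 := by
  have h1 := ncard_det_eq (D := 2) (n := 18192384) (by simp)
  have h2 := ncard_det_eq (D := 4) (n := 3752952) (by simp)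
  have h3 := ncard_det_eq (D := 6) (n := 459648) (by simp)
  have h4 := ncard_det_eq (D := 8) (n := 57456) (by simp)
  have h6 := ncard_det_eq (D := 12) (n := 378) (by simp)
  have h8 := ncard_det_eq (D := 16) (n := 1) (by simp)
  norm_num only [Nat.cast_ofNat] at h1 h2 h3 h4 h6 h8
  rw [setOf_invariant_eq_singleEntry, setOf_invariant_eq_diff, setOf_invariant_eq_eight,
    setOf_invariant_eq (d := 1) (by norm_num) (by norm_num),
    setOf_invariant_eq (d := 2) (by norm_num) (by norm_num),
    setOf_invariant_eq (d := 3) (by norm_num) (by norm_num),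
    setOf_invariant_eq (d := 6) (by norm_num) (by norm_num)]
  refine ⟨h1, h2, h3, ?_, h6, ncard_singleEntry, h8⟩
  have hsub : singleEntry ⊆ {T ∈ posTwo | T.det = 4} := fun T hT =>
    ⟨(singleEntry_spec hT).1, (singleEntry_spec hT).2.1⟩
  rw [Set.ncard_sdiff hsub (finite_posTwo.subset fun T hT => (singleEntry_spec hT).1), h4,
    ncard_singleEntry]

/-- Semi-definite but not positive `T` contribute zero, so the infinite sum reduces to the finite
set `posTwo`. -/
theorem restrictedCoeff_eq_sum (k : ℕ) (α : ℕ → ℂ) :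
    restrictedCoeff (ikedaCoeff k α) (Matrix.diagonal ![2, 2, 2]) =
      ∑ T ∈ finite_posTwo.toFinset, ikedaCoeff k α T := by
  set s := {T : Jordan | T.IsIntegral ∧ T.IsNonneg ∧
    T.symPart = Matrix.diagonal ![2, 2, 2]} with hs
  change ∑' T : s, ikedaCoeff k α T = _
  rw [tsum_subtype s, tsum_eq_sum (s := finite_posTwo.toFinset)]
  · refine Finset.sum_congr rfl fun T hT => Set.indicator_of_mem ?_ _
    obtain ⟨hi, ⟨h1, h2, h3, h4, h5, h6, h7⟩, hd⟩ := finite_posTwo.mem_toFinset.1 hT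
    exact ⟨hi, ⟨h1.le, h2.le, h3.le, h4.le, h5.le, h6.le, h7.le⟩, hd⟩
  · intro T hT
    by_cases hTs : T ∈ s
    · rw [Set.indicator_of_mem hTs, ikedaCoeff, if_neg]
      rintro ⟨hi, hp⟩
      exact hT (finite_posTwo.mem_toFinset.2 ⟨hi, hp, hTs.2.2⟩)
    · exact Set.indicator_of_notMem hTs _

theorem sum_posTwo_eq (v : ℕ × ℕ × ℚ → ℂ) :
    ∑ T ∈ finite_posTwo.toFinset, v T.invariant =
      ∑ d ∈ invariants, ({T ∈ posTwo | T.invariant = d}.ncard : ℂ) * v d := by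
  classical
  rw [← Finset.sum_fiberwise_of_maps_to (t := invariants) (g := Jordan.invariant)
    fun T hT => invariant_mem_invariants (finite_posTwo.mem_toFinset.1 hT)]
  refine Finset.sum_congr rfl fun d _ => ?_
  rw [Finset.sum_congr rfl fun T hT => by rw [(Finset.mem_filter.1 hT).2], Finset.sum_const,
    nsmul_eq_mul, ← Set.ncard_coe_finset]
  congr 3
  ext T
  simp

theorem restrictedCoeff_eq {k : ℕ} (hk : 20 ≤ 2 * k) {f : CuspForm 𝒮ℒ (2 * (k : ℤ) - 8)}
    (hf : IsNormalizedEigenform f) {α : ℕ → ℂ} (hα : IsSatake k f α) :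
    restrictedCoeff (ikedaCoeff k α) (Matrix.diagonal ![2, 2, 2]) =
      ∑ d ∈ invariants,
        ({T ∈ posTwo | T.invariant = d}.ncard : ℂ) * classCoeff k (fourierCoeff f) d := by
  rw [restrictedCoeff_eq_sum, ← sum_posTwo_eq]
  refine Finset.sum_congr rfl fun T hT => ?_
  have hT' := finite_posTwo.mem_toFinset.1 hT
  exact ikedaCoeff_eq_classCoeff hk hf hα hT'.1 hT'.2.1 (invariant_mem_invariants hT')

theorem sum_invariants (v : ℕ × ℕ × ℚ → ℂ) :
    ∑ d ∈ invariants, v d = v (1, 1, 1) + v (1, 1, 2) + v (1, 1, 3) + v (1, 1, 4) + v (1, 1, 6) +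
      v (1, 2, 4) + v (2, 4, 8) := by
  rw [invariants]
  repeat rw [Finset.sum_insert (by simp)]
  rw [Finset.sum_singleton]
  ring

end ExceptionalRestriction

end

/-! ### The classification and the restricted Fourier coefficient -/

theorem mainTheorem6 (k : ℕ) (hk : 20 ≤ 2 * k)
    (f : CuspForm 𝒮ℒ (2 * (k : ℤ) - 8)) (hf : ExceptionalRestriction.IsNormalizedEigenform f)
    (α : ℕ → ℂ) (hα : ExceptionalRestriction.IsSatake k f α)
    (a : ℕ → ℂ) (ha : ∀ n, a n = ExceptionalRestriction.fourierCoeff f n)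
    (H : Matrix (Fin 3) (Fin 3) ℚ) (hH : H = Matrix.diagonal ![2, 2, 2])
    (P : Set ExceptionalRestriction.Jordan)
    (hP : P = {T | T.IsIntegral ∧ T.IsPos ∧ T.symPart = H}) :
    ((∀ T ∈ P, T.invariant ∈
        ({(1, 1, 1), (1, 1, 2), (1, 1, 3), (1, 1, 4), (1, 1, 6), (1, 2, 4), (2, 4, 8)} :
          Set (ℕ × ℕ × ℚ))) ∧
      {T ∈ P | T.invariant = (1, 1, 1)}.ncard = 18192384 ∧
      {T ∈ P | T.invariant = (1, 1, 2)}.ncard = 3752952 ∧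
      {T ∈ P | T.invariant = (1, 1, 3)}.ncard = 459648 ∧
      {T ∈ P | T.invariant = (1, 1, 4)}.ncard = 55188 ∧
      {T ∈ P | T.invariant = (1, 1, 6)}.ncard = 378 ∧
      {T ∈ P | T.invariant = (1, 2, 4)}.ncard = 2268 ∧
      {T ∈ P | T.invariant = (2, 4, 8)}.ncard = 1) ∧
    ExceptionalRestriction.restrictedCoeff (ExceptionalRestriction.ikedaCoeff k α) H =
      a 2 ^ 3 + 270 * 2 ^ (2 * k - 9) * a 2 + 2268 * (a 4 + 2 ^ (2 * k - 5)) + 378 * a 6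
        + 55188 * a 4 + 459648 * a 3 + 3752952 * a 2 + 18192384 := by
  obtain rfl : a = ExceptionalRestriction.fourierCoeff f := funext ha
  subst hH
  obtain rfl : P = ExceptionalRestriction.posTwo := hP
  refine ⟨⟨fun T hT => ?_, ExceptionalRestriction.ncard_invariant⟩, ?_⟩
  · simpa [ExceptionalRestriction.invariants] using
      ExceptionalRestriction.invariant_mem_invariants hT
  · obtain ⟨h1, h2, h3, h4, h6, h5, h8⟩ := ExceptionalRestriction.ncard_invariant
    rw [ExceptionalRestriction.restrictedCoeff_eq hk hf hα, ExceptionalRestriction.sum_invariants,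
      h1, h2, h3, h4, h5, h6, h8]
    simp only [ExceptionalRestriction.classCoeff, Prod.mk.injEq]
    norm_num
    ring
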